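/- Let $(\Omega,\mathcal F,\mathbb P)$ be a complete probability space carrying a two-sided Brownian motion $W=(W_t)_{t\in\mathbb R}$ and an independent Brownian motion $B=(B_t)_{t\ge 0}$. Fix $T>0$, $\rho\in(0,1)$, $\alpha>0$ and $\beta>1$. Let $\mathbb F=(\mathcal F_t)_{t\in[0,T]}$ be the completed natural filtration of $(W,B)$, i.e. $\mathcal F_t$ is generated by $W_s$ ($s\le t$), $B_s$ ($0\le s\le t$) and the null sets, and put $M=\rho W+\sqrt{1-\rho^2}\,B$ on $[0,T]$, with quadratic variation $\langle M\rangle$. Let $\mathcal D_\beta$ be the space of $\mathbb F$-progressively measurable processes $\lambda=(\lambda_t)_{t\in[0,T]}$ with $\int_0^T\lambda_t^2\,d\langle M\rangle_t<\infty$ a.s. and $$\|\lambda\|_\beta:=\mathbb E\Big[\Big(\int_0^T\lambda_t^2\,d\langle M\rangle_t\Big)^{\beta}\Big]^{\frac1{2\beta}}<\infty ,$$ processes at distance $0$ being identified. For $H\in(0,1)$, $t\ge0$, $s\in\mathbb R$ let $$K^H(t,s)=C(H)\Big((t-s)_+^{H-\frac12}-(-s)_+^{H-\frac12}\Big),\qquad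 C(H)=\Big(\int_0^\infty\big((1+s)^{H-\frac12}-s^{H-\frac12}\big)^2ds+\frac1{2H}\Big)^{-\frac12},$$ where $x_+^{a}:=0$ for $x\le 0$ and every $a\in\mathbb R$. For each $H\in(0,1)$ let $B^H$ be a fractional Brownian motion with Hurst parameter $H$ (a continuous centred Gaussian process with $\mathrm{Cov}(B^H_s,B^H_t)=\frac12(|s|^{2H}+|t|^{2H}-|t-s|^{2H})$) such that $B^H_t=\int_{\mathbb R}K^H(t,s)\,dW_s$ a.s. for every $t\ge 0$. Let $\lambda_0$ be an $\mathcal F_0$-measurable random variable with $\mathbb E|\lambda_0|^{2\beta}<\infty$ that does not depend on $H$ (for instance a constant), and let $$\lambda^H_t=e^{-\alpha t}\Big(\lambda_0+\int_0^te^{\alpha u}\,dB^H_u\Big),\qquad t\in[0,T],$$ be the fractional Ornstein–Uhlenbeck process, i.e. the solution of $d\lambda^H_t=-\alpha\lambda^H_t\,dt+dB^H_t$ started at $\lambda_0$. Then the following hold. (a) For all $H\in(0,1)$, $t\ge0$, $s\in\mathbb R$ the partial derivative $\partial_HK^H(t,s)$ exists, and for every $\omega$ and $t\in[0,T]$ the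 integral $\int_0^te^{\alpha u}\,dB^H_u(\omega)$ exists as a pathwise Riemann–Stieltjes integral. (b) For every $H\in(0,1)$ the process of Wiener integrals $Y^H_t=\int_{\mathbb R}\partial_HK^H(t,s)\,dW_s$, $t\in[0,T]$, is well defined and has an $\mathbb F$-progressively measurable version. (c) For every $H\in(0,1)$ one has $\lambda^H\in\mathcal D_\beta$; for every progressively measurable version $Y^H$ as in (b), almost surely $u\mapsto Y^H_ue^{\alpha u}$ is integrable on $[0,T]$, the process $$D\lambda^H_t=\int_{\mathbb R}\partial_HK^H(t,s)\,dW_s-\alpha e^{-\alpha t}\int_0^t\Big(\int_{\mathbb R}\partial_HK^H(u,s)\,dW_s\Big)e^{\alpha u}\,du,\qquad t\in[0,T],$$ (formed with $Y^H$) belongs to $\mathcal D_\beta$, and the mapping $(0,1)\to\mathcal D_\beta$, $H\mapsto\lambda^H$, is Fréchet differentiable at $H$ with derivative $\varepsilon\mapsto\varepsilon\,D\lambda^H$. -/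

import Mathlib

open MeasureTheory ProbabilityTheory Filter Set
open scoped NNReal ENNReal Topology

namespace FracOU

/-! ### Fractional Brownian motion and its driving noise -/

/-- A fractional Brownian motion with Hurst parameter `H`, indexed by the whole line: a continuous
centred Gaussian process with covariance `(|s|^{2H} + |t|^{2H} - |t - s|^{2H}) / 2`.
For `H = 1/2` this is a two-sided Brownian motion. -/
structure IsFractionalBrownianMotion {Ω : Type*} {m : MeasurableSpace Ω} (H : ℝ)
    (X : ℝ → Ω → ℝ) (P : Measure Ω) : Prop where
  gaussian : IsGaussianProcess X P
  mean_zero : ∀ t, ∫ ω, X t ω ∂P = 0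
  covariance_eq : ∀ s t,
    cov[X s, X t; P] = (|s| ^ (2 * H) + |t| ^ (2 * H) - |t - s| ^ (2 * H)) / 2
  continuous_paths : ∀ ω, Continuous fun t => X t ω

/-- The function `x ↦ x₊ ^ a`, with the usual convention that it vanishes for `x ≤ 0`
(also when `a ≤ 0`). -/
noncomputable def posPow (x a : ℝ) : ℝ := if 0 < x then x ^ a else 0

/-- The normalising constant `C(H)` of the Mandelbrot–Van Ness kernel. -/
noncomputable def normConst (H : ℝ) : ℝ :=
  ((∫ s in Ioi (0 : ℝ), ((1 + s) ^ (H - 1 / 2) - s ^ (H - 1 / 2)) ^ 2) + 1 / (2 * H))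
    ^ (-(1 / 2) : ℝ)

/-- The Mandelbrot–Van Ness kernel `K^H(t, s)`. -/
noncomputable def kernel (H t s : ℝ) : ℝ :=
  normConst H * (posPow (t - s) (H - 1 / 2) - posPow (-s) (H - 1 / 2))

/-- The partial derivative `∂_H K^H(t, s)`. -/
noncomputable def kernelDeriv (H t s : ℝ) : ℝ := deriv (fun h => kernel h t s) H

/-- The step function `∑ i < n, c i * 1_{(a i, b i]}`. -/
noncomputable def stepFun (n : ℕ) (c a b : ℕ → ℝ) (s : ℝ) : ℝ :=
  ∑ i ∈ Finset.range n, c i * (Ioc (a i) (b i)).indicator (fun _ => (1 : ℝ)) s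

/-- The integral `∑ i < n, c i * (W (b i) - W (a i))` of a step function against `W`. -/
noncomputable def stepIntegral {Ω : Type*} (W : ℝ → Ω → ℝ) (n : ℕ) (c a b : ℕ → ℝ) (ω : Ω) : ℝ :=
  ∑ i ∈ Finset.range n, c i * (W (b i) ω - W (a i) ω)

/-- `X` is (a version of) the Wiener integral `∫_ℝ f(s) dW_s` of `f ∈ L²(ℝ)`: there are step
functions which converge to `f` in `L²(ℝ)` and whose integrals converge to `X` in `L²(P)`. -/
def IsWienerIntegral {Ω : Type*} {m : MeasurableSpace Ω} (W : ℝ → Ω → ℝ) (P : Measure Ω)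
    (f : ℝ → ℝ) (X : Ω → ℝ) : Prop :=
  MemLp f 2 volume ∧ MemLp X 2 P ∧
    ∀ ε : ℝ≥0∞, 0 < ε → ∃ (n : ℕ) (c a b : ℕ → ℝ), (∀ i < n, a i ≤ b i) ∧
      eLpNorm (fun s => f s - stepFun n c a b s) 2 volume ≤ ε ∧
      eLpNorm (fun ω => X ω - stepIntegral W n c a b ω) 2 P ≤ ε

/-! ### Partitions, Riemann–Stieltjes integrals, the Ornstein–Uhlenbeck process -/

/-- `x 0 ≤ x 1 ≤ ⋯ ≤ x n` is a partition of `[a, b]` of mesh less than `δ`. -/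
structure IsPartition (a b δ : ℝ) (n : ℕ) (x : ℕ → ℝ) : Prop where
  left : x 0 = a
  right : x n = b
  le_succ : ∀ i < n, x i ≤ x (i + 1)
  mesh_lt : ∀ i < n, x (i + 1) - x i < δ

/-- `I` is the Riemann–Stieltjes integral `∫_a^b f dg`: the limit, as the mesh tends to zero, of
the Riemann–Stieltjes sums over tagged partitions. -/
def HasRSIntegral (f g : ℝ → ℝ) (a b I : ℝ) : Prop :=
  ∀ ε > 0, ∃ δ > 0, ∀ (n : ℕ) (x ξ : ℕ → ℝ), IsPartition a b δ n x →
    (∀ i < n, ξ i ∈ Icc (x i) (x (i + 1))) →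
    |∑ i ∈ Finset.range n, f (ξ i) * (g (x (i + 1)) - g (x i)) - I| < ε

open Classical in
/-- The Riemann–Stieltjes integral `∫_a^b f dg` (and `0` if it does not exist). -/
noncomputable def rsIntegral (f g : ℝ → ℝ) (a b : ℝ) : ℝ :=
  if h : ∃ I, HasRSIntegral f g a b I then h.choose else 0

/-- The fractional Ornstein–Uhlenbeck process
`λ_t = e^{-αt} (λ_0 + ∫_0^t e^{αu} dZ_u)` driven by `Z`, with a pathwise Riemann–Stieltjes
integral. -/
noncomputable def ornsteinUhlenbeck {Ω : Type*} (α : ℝ) (lam0 : Ω → ℝ) (Z : ℝ → Ω → ℝ)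
    (t : ℝ) (ω : Ω) : ℝ :=
  Real.exp (-α * t) *
    (lam0 ω + rsIntegral (fun u => Real.exp (α * u)) (fun u => Z u ω) 0 t)

/-- The process `Y_t - α e^{-αt} ∫_0^t Y_u e^{αu} du`. -/
noncomputable def derivProcess {Ω : Type*} (α : ℝ) (Y : ℝ → Ω → ℝ) (t : ℝ) (ω : Ω) : ℝ :=
  Y t ω - α * Real.exp (-α * t) * ∫ u in (0 : ℝ)..t, Y u ω * Real.exp (α * u)

/-! ### Filtration, progressive measurability, quadratic variation -/

/-- The completed natural filtration of `(W, B)`, where `W` is indexed by the whole line and `B` by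
the half-line: at time `t` it is generated by `W_s`, `s ≤ t`, by `B_s`, `0 ≤ s ≤ t`, and by the
null sets. -/
noncomputable def completedFiltration {Ω : Type*} {m : MeasurableSpace Ω} (P : Measure Ω)
    (W : ℝ → Ω → ℝ) (B : ℝ≥0 → Ω → ℝ) (hW : ∀ t, Measurable (W t)) (hB : ∀ t, Measurable (B t)) :
    Filtration ℝ m where
  seq t :=
    (⨆ s : ℝ, ⨆ _ : s ≤ t, MeasurableSpace.comap (W s) inferInstance) ⊔
      (⨆ s : ℝ≥0, ⨆ _ : (s : ℝ) ≤ t, MeasurableSpace.comap (B s) inferInstance) ⊔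
      MeasurableSpace.generateFrom {N | MeasurableSet N ∧ P N = 0}
  mono' := by
    intro t t' h
    refine sup_le_sup (sup_le_sup ?_ ?_) le_rfl
    · exact iSup_mono fun s => iSup_mono' fun hs => ⟨hs.trans h, le_rfl⟩
    · exact iSup_mono fun s => iSup_mono' fun hs => ⟨hs.trans h, le_rfl⟩
  le' t := by
    refine sup_le (sup_le ?_ ?_) ?_
    · exact iSup_le fun s => iSup_le fun _ => (hW s).comap_le
    · exact iSup_le fun s => iSup_le fun _ => (hB s).comap_le
    · exact MeasurableSpace.generateFrom_le fun N hN => hN.1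

/-- `(X_t)_{t ∈ [0, T]}` is progressively measurable: for every `t ∈ [0, T]` its restriction to
`[0, t] × Ω` is measurable for the product of the Borel σ-algebra with `F t`. -/
def IsProgressiveOn {Ω : Type*} {m : MeasurableSpace Ω} (F : Filtration ℝ m) (T : ℝ)
    (X : ℝ → Ω → ℝ) : Prop :=
  ∀ t ∈ Icc 0 T, Measurable[Subtype.instMeasurableSpace.prod (F t)]
    fun p : Icc (0 : ℝ) t × Ω => X p.1 p.2

/-- (A version of) the quadratic variation `⟨M⟩` on `[0, T]` of a continuous process `M`: an
adapted, continuous, nondecreasing process such that, for every `t ∈ [0, T]`, the sums of the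
squared increments of `M` along partitions of `[0, t]` converge to `⟨M⟩_t` in probability as the
mesh tends to zero. -/
structure QuadraticVariation {Ω : Type*} {m : MeasurableSpace Ω} (P : Measure Ω)
    (F : Filtration ℝ m) (T : ℝ) (M : ℝ → Ω → ℝ) where
  path : Ω → StieltjesFunction ℝ
  adapted : ∀ t ∈ Icc 0 T, Measurable[F t] fun ω => path ω t
  continuousOn_path : ∀ ω, ContinuousOn (path ω) (Icc 0 T)
  tendsto_sq : ∀ t ∈ Icc 0 T, ∀ ε : ℝ, 0 < ε → ∃ δ > 0, ∀ (n : ℕ) (x : ℕ → ℝ),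
    IsPartition 0 t δ n x →
      P {ω | ε ≤ |∑ i ∈ Finset.range n, (M (x (i + 1)) ω - M (x i) ω) ^ 2 - path ω t|}
        ≤ ENNReal.ofReal ε

section Space

variable {Ω : Type*} {m : MeasurableSpace Ω} {P : Measure Ω} {F : Filtration ℝ m} {T : ℝ}
  {M : ℝ → Ω → ℝ}

/-- The random variable `∫_0^T X_t² d⟨M⟩_t`, with values in `[0, ∞]`. -/
noncomputable def energy (Q : QuadraticVariation P F T M) (X : ℝ → Ω → ℝ) (ω : Ω) : ℝ≥0∞ :=
  ∫⁻ t in Ioc 0 T, ‖X t ω‖ₑ ^ 2 ∂(Q.path ω).measure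

/-- The quantity `E[(∫_0^T X_t² d⟨M⟩_t)^β]^{1/(2β)}`, with values in `[0, ∞]`. -/
noncomputable def betaNorm (Q : QuadraticVariation P F T M) (β : ℝ) (X : ℝ → Ω → ℝ) : ℝ≥0∞ :=
  (∫⁻ ω, energy Q X ω ^ β ∂P) ^ (1 / (2 * β))

/-- The random measure `d⟨M⟩` on `(0, T]`. -/
noncomputable def clock (Q : QuadraticVariation P F T M) (ω : Ω) : Measure ℝ :=
  (Q.path ω).measure.restrict (Ioc 0 T)

theorem clock_Iic (Q : QuadraticVariation P F T M) (ω : Ω) (t : ℝ) :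
    clock Q ω (Iic t) = ENNReal.ofReal (Q.path ω (min T t) - Q.path ω 0) := by
  rw [clock, Measure.restrict_apply measurableSet_Iic, inter_comm, Ioc_inter_Iic,
    StieltjesFunction.measure_Ioc]

instance instFiniteClock (Q : QuadraticVariation P F T M) (ω : Ω) : IsFiniteMeasure (clock Q ω) := by
  refine ⟨?_⟩
  rw [clock, Measure.restrict_apply_univ, StieltjesFunction.measure_Ioc]
  exact ENNReal.ofReal_lt_top

theorem measurable_clock (Q : QuadraticVariation P F T M) : Measurable (clock Q) := by
  have key : ∀ t, Measurable fun ω => clock Q ω (Iic t) := by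
    intro t
    simp only [clock_Iic]
    rcases lt_or_ge (min T t) 0 with h | h
    · have : ∀ ω, ENNReal.ofReal (Q.path ω (min T t) - Q.path ω 0) = 0 := fun ω =>
        ENNReal.ofReal_of_nonpos (sub_nonpos.2 ((Q.path ω).mono h.le))
      simp only [this]
      exact measurable_const
    · have hT : 0 ≤ T := h.trans (min_le_left _ _)
      have h1 := (Q.adapted (min T t) ⟨h, min_le_left _ _⟩).mono (F.le _) le_rfl
      have h0 := (Q.adapted 0 ⟨le_rfl, hT⟩).mono (F.le _) le_rfl
      exact (h1.sub h0).ennreal_ofReal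
  refine Measurable.measure_of_isPiSystem (borel_eq_generateFrom_Iic ℝ ▸
    (BorelSpace.measurable_eq (α := ℝ))) isPiSystem_Iic ?_ ?_
  · rintro _ ⟨t, rfl⟩
    exact key t
  · have : ∀ ω, clock Q ω univ = clock Q ω (Iic T) := by
      intro ω
      rw [clock, Measure.restrict_apply_univ, Measure.restrict_apply measurableSet_Iic,
        inter_comm, Ioc_inter_Iic, min_self]
    simp only [this]
    exact key T

theorem measurable_lintegral_clock (Q : QuadraticVariation P F T M) {f : Ω → ℝ → ℝ≥0∞}
    (hf : Measurable (Function.uncurry f)) : Measurable fun ω => ∫⁻ t, f ω t ∂(clock Q ω) := by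
  have hc := measurable_clock Q
  have hm : Measurable fun ω => (1 + clock Q ω univ) :=
    measurable_const.add ((Measure.measurable_coe MeasurableSet.univ).comp hc)
  let κ : Kernel Ω ℝ :=
    ⟨fun ω => (1 + clock Q ω univ)⁻¹ • clock Q ω, by
      refine Measure.measurable_of_measurable_coe _ fun s hs => ?_
      simp only [Measure.smul_apply, smul_eq_mul]
      exact hm.inv.mul ((Measure.measurable_coe hs).comp hc)⟩
  have : IsFiniteKernel κ := by
    refine ⟨1, ENNReal.one_lt_top, fun ω => ?_⟩
    change ((1 + clock Q ω univ)⁻¹ • clock Q ω) univ ≤ 1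
    rw [Measure.smul_apply, smul_eq_mul, mul_comm, ← div_eq_mul_inv]
    exact ENNReal.div_le_of_le_mul (by rw [one_mul]; exact le_add_self)
  have h := Measurable.lintegral_kernel_prod_right (κ := κ) hf
  have e : ∀ ω, ∫⁻ t, f ω t ∂(clock Q ω) = (1 + clock Q ω univ) * ∫⁻ t, f ω t ∂(κ ω) := by
    intro ω
    change _ = (1 + clock Q ω univ) * ∫⁻ t, f ω t ∂((1 + clock Q ω univ)⁻¹ • clock Q ω)
    rw [lintegral_smul_measure, smul_eq_mul, ← mul_assoc, ENNReal.mul_inv_cancel, one_mul]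
    · simp
    · simp [measure_ne_top]
  simp only [e]
  exact hm.mul h

theorem IsProgressiveOn.measurable_indicator {X : ℝ → Ω → ℝ} (hX : IsProgressiveOn F T X) :
    Measurable fun p : Ω × ℝ => (Icc 0 T).indicator (fun t => X t p.1) p.2 := by
  rcases lt_or_ge T 0 with h | h
  · simp [Icc_eq_empty (not_le.2 h)]
  have h1 : Measurable fun p : Icc (0 : ℝ) T × Ω => X p.1 p.2 :=
    (hX T ⟨h, le_rfl⟩).mono (sup_le_sup le_rfl (MeasurableSpace.comap_mono (F.le T))) le_rfl
  have hs : MeasurableSet {p : Ω × ℝ | p.2 ∈ Icc 0 T} := measurable_snd measurableSet_Icc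
  refine measurable_of_restrict_of_restrict_compl hs ?_ ?_
  · have e : (fun q : {p : Ω × ℝ | p.2 ∈ Icc 0 T} =>
        (Icc 0 T).indicator (fun t => X t q.1.1) q.1.2) =
        fun q => X q.1.2 q.1.1 :=
      funext fun q => indicator_of_mem (show q.1.2 ∈ Icc 0 T from q.2) fun t => X t q.1.1
    change Measurable fun q : {p : Ω × ℝ | p.2 ∈ Icc 0 T} =>
      (Icc 0 T).indicator (fun t => X t q.1.1) q.1.2
    rw [e]
    exact h1.comp (Measurable.prodMk
      ((measurable_snd.comp measurable_subtype_coe).subtype_mk (h := fun q => q.2))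
      (measurable_fst.comp measurable_subtype_coe))
  · have e : (fun q : ({p : Ω × ℝ | p.2 ∈ Icc 0 T}ᶜ : Set (Ω × ℝ)) =>
        (Icc 0 T).indicator (fun t => X t q.1.1) q.1.2) = fun _ => 0 :=
      funext fun q => indicator_of_notMem (show q.1.2 ∉ Icc 0 T from q.2) fun t => X t q.1.1
    change Measurable fun q : ({p : Ω × ℝ | p.2 ∈ Icc 0 T}ᶜ : Set (Ω × ℝ)) =>
      (Icc 0 T).indicator (fun t => X t q.1.1) q.1.2
    rw [e]
    exact measurable_const

theorem energy_eq (Q : QuadraticVariation P F T M) (X : ℝ → Ω → ℝ) (ω : Ω) :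
    energy Q X ω = ∫⁻ t, ‖(Icc 0 T).indicator (fun t => X t ω) t‖ₑ ^ 2 ∂(clock Q ω) := by
  refine setLIntegral_congr_fun measurableSet_Ioc fun t ht => ?_
  simp only [indicator_of_mem (Ioc_subset_Icc_self ht)]

theorem measurable_energy (Q : QuadraticVariation P F T M) {X : ℝ → Ω → ℝ}
    (hX : IsProgressiveOn F T X) : Measurable (energy Q X) := by
  have : energy Q X =
      fun ω => ∫⁻ t, ‖(Icc 0 T).indicator (fun t => X t ω) t‖ₑ ^ 2 ∂(clock Q ω) :=
    funext (energy_eq Q X)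
  rw [this]
  exact measurable_lintegral_clock Q (hX.measurable_indicator.enorm.pow_const 2)

theorem energy_add_le (Q : QuadraticVariation P F T M) {X Y : ℝ → Ω → ℝ}
    (hX : IsProgressiveOn F T X) (hY : IsProgressiveOn F T Y) (ω : Ω) :
    energy Q (X + Y) ω ^ (1 / 2 : ℝ) ≤ energy Q X ω ^ (1 / 2 : ℝ) + energy Q Y ω ^ (1 / 2 : ℝ) := by
  simp only [energy_eq]
  have hx : Measurable fun t => ‖(Icc 0 T).indicator (fun t => X t ω) t‖ₑ :=
    (hX.measurable_indicator.comp (measurable_prodMk_left (x := ω))).enorm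
  have hy : Measurable fun t => ‖(Icc 0 T).indicator (fun t => Y t ω) t‖ₑ :=
    (hY.measurable_indicator.comp (measurable_prodMk_left (x := ω))).enorm
  have h := ENNReal.lintegral_Lp_add_le (μ := clock Q ω) hx.aemeasurable hy.aemeasurable one_le_two
  simp only [ENNReal.rpow_ofNat] at h
  refine le_trans (ENNReal.rpow_le_rpow (lintegral_mono fun t => ?_) (by norm_num)) h
  refine pow_le_pow_left₀ zero_le ?_ 2
  have e : (Icc 0 T).indicator (fun t => (X + Y) t ω) t =
      (Icc 0 T).indicator (fun t => X t ω) t + (Icc 0 T).indicator (fun t => Y t ω) t := by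
    by_cases ht : t ∈ Icc 0 T <;> simp [ht]
  rw [e]
  exact enorm_add_le _ _

theorem energy_smul (Q : QuadraticVariation P F T M) (c : ℝ) (X : ℝ → Ω → ℝ) (ω : Ω) :
    energy Q (c • X) ω = ‖c‖ₑ ^ 2 * energy Q X ω := by
  simp only [energy, Pi.smul_apply, smul_eq_mul, enorm_mul, mul_pow]
  exact lintegral_const_mul' _ _ (by simp)

theorem betaNorm_add_le (Q : QuadraticVariation P F T M) {β : ℝ} (hβ : 1 < β) {X Y : ℝ → Ω → ℝ}
    (hX : IsProgressiveOn F T X) (hY : IsProgressiveOn F T Y) :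
    betaNorm Q β (X + Y) ≤ betaNorm Q β X + betaNorm Q β Y := by
  have e : ∀ (Z : ℝ → Ω → ℝ) ω, energy Q Z ω ^ β = (energy Q Z ω ^ (1 / 2 : ℝ)) ^ (2 * β) := by
    intro Z ω
    rw [← ENNReal.rpow_mul]
    congr 1
    ring
  simp only [betaNorm, e]
  have h := ENNReal.lintegral_Lp_add_le (μ := P) (p := 2 * β)
    ((measurable_energy Q hX).pow_const (1 / 2 : ℝ)).aemeasurable
    ((measurable_energy Q hY).pow_const (1 / 2 : ℝ)).aemeasurable (by linarith)
  refine le_trans (ENNReal.rpow_le_rpow (lintegral_mono fun ω => ?_) (by positivity)) h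
  exact ENNReal.rpow_le_rpow (energy_add_le Q hX hY ω) (by positivity)

theorem betaNorm_smul (Q : QuadraticVariation P F T M) {β : ℝ} (hβ : 1 < β) (c : ℝ)
    (X : ℝ → Ω → ℝ) : betaNorm Q β (c • X) = ‖c‖ₑ * betaNorm Q β X := by
  have hb : 0 < β := by linarith
  simp only [betaNorm, energy_smul]
  simp only [ENNReal.mul_rpow_of_nonneg _ _ hb.le]
  rw [lintegral_const_mul' _ _ (ENNReal.rpow_ne_top_of_nonneg hb.le (by simp)),
    ENNReal.mul_rpow_of_nonneg _ _ (by positivity), ← ENNReal.rpow_natCast, ← ENNReal.rpow_mul,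
    ← ENNReal.rpow_mul]
  congr 1
  have : ((2 : ℕ) : ℝ) * (β * (1 / (2 * β))) = 1 := by
    push_cast
    field_simp
  rw [this, ENNReal.rpow_one]

/-- The processes `X` which are progressively measurable on `[0, T]` and satisfy
`∫_0^T X_t² d⟨M⟩_t < ∞` almost surely and `E[(∫_0^T X_t² d⟨M⟩_t)^β] < ∞`. -/
def processSpace (Q : QuadraticVariation P F T M) {β : ℝ} (hβ : 1 < β) :
    Submodule ℝ (ℝ → Ω → ℝ) where
  carrier := {X | IsProgressiveOn F T X ∧ (∀ᵐ ω ∂P, energy Q X ω < ∞) ∧ betaNorm Q β X < ∞}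
  zero_mem' := by
    have h0 : energy Q (0 : ℝ → Ω → ℝ) = 0 := by
      funext ω
      simp [energy]
    refine ⟨fun t _ => measurable_const, ?_, ?_⟩
    · simp [h0]
    · have hb : 0 < β := by linarith
      simp [betaNorm, h0, ENNReal.zero_rpow_of_pos hb, hb]
  add_mem' := by
    rintro X Y ⟨hX, hX1, hX2⟩ ⟨hY, hY1, hY2⟩
    refine ⟨fun t ht => (hX t ht).add (hY t ht), ?_,
      (betaNorm_add_le Q hβ hX hY).trans_lt (ENNReal.add_lt_top.2 ⟨hX2, hY2⟩)⟩
    filter_upwards [hX1, hY1] with ω h1 h2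
    have h := (energy_add_le Q hX hY ω).trans_lt (ENNReal.add_lt_top.2
      ⟨ENNReal.rpow_lt_top_of_nonneg (by norm_num) h1.ne,
        ENNReal.rpow_lt_top_of_nonneg (by norm_num) h2.ne⟩)
    exact (ENNReal.rpow_lt_top_iff_of_pos (by norm_num)).1 h
  smul_mem' := by
    rintro c X ⟨hX, hX1, hX2⟩
    refine ⟨fun t ht => (hX t ht).const_mul c, ?_, ?_⟩
    · filter_upwards [hX1] with ω h
      rw [energy_smul]
      exact ENNReal.mul_lt_top (by simp) h
    · rw [betaNorm_smul Q hβ]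
      exact ENNReal.mul_lt_top enorm_lt_top hX2

/-- The space `processSpace`, without the topology of pointwise convergence. -/
def PreD (Q : QuadraticVariation P F T M) {β : ℝ} (hβ : 1 < β) : Type _ := processSpace Q hβ

noncomputable instance (Q : QuadraticVariation P F T M) {β : ℝ} (hβ : 1 < β) :
    AddCommGroup (PreD Q hβ) :=
  inferInstanceAs (AddCommGroup (processSpace Q hβ))

noncomputable instance (Q : QuadraticVariation P F T M) {β : ℝ} (hβ : 1 < β) :
    Module ℝ (PreD Q hβ) :=
  inferInstanceAs (Module ℝ (processSpace Q hβ))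

/-- The seminorm `‖X‖_β = E[(∫_0^T X_t² d⟨M⟩_t)^β]^{1/(2β)}`. -/
noncomputable def betaSeminorm (Q : QuadraticVariation P F T M) {β : ℝ} (hβ : 1 < β) :
    AddGroupSeminorm (PreD Q hβ) where
  toFun X := (betaNorm Q β X.1).toReal
  map_zero' := by
    have h := betaNorm_smul Q hβ 0 (0 : ℝ → Ω → ℝ)
    rw [smul_zero, enorm_zero, zero_mul] at h
    change (betaNorm Q β (0 : ℝ → Ω → ℝ)).toReal = 0
    rw [h, ENNReal.toReal_zero]
  add_le' X Y := by
    change (betaNorm Q β (X.1 + Y.1)).toReal ≤ _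
    rw [← ENNReal.toReal_add X.2.2.2.ne Y.2.2.2.ne]
    exact ENNReal.toReal_mono (ENNReal.add_ne_top.2 ⟨X.2.2.2.ne, Y.2.2.2.ne⟩)
      (betaNorm_add_le Q hβ X.2.1 Y.2.1)
  neg' X := by
    change (betaNorm Q β (-X.1)).toReal = _
    rw [← neg_one_smul ℝ X.1, betaNorm_smul Q hβ]
    simp

noncomputable instance (Q : QuadraticVariation P F T M) {β : ℝ} (hβ : 1 < β) :
    SeminormedAddCommGroup (PreD Q hβ) :=
  (betaSeminorm Q hβ).toSeminormedAddCommGroup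

noncomputable instance (Q : QuadraticVariation P F T M) {β : ℝ} (hβ : 1 < β) :
    NormedSpace ℝ (PreD Q hβ) where
  norm_smul_le c X := by
    change (betaNorm Q β (c • X.1)).toReal ≤ ‖c‖ * (betaNorm Q β X.1).toReal
    rw [betaNorm_smul Q hβ, ENNReal.toReal_mul, toReal_enorm]

/-- The space `𝓓_β` with the norm `‖X‖_β = E[(∫_0^T X_t² d⟨M⟩_t)^β]^{1/(2β)}`; as usual, processes
at distance zero from each other are identified. -/
abbrev DSpace (Q : QuadraticVariation P F T M) {β : ℝ} (hβ : 1 < β) : Type _ :=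
  SeparationQuotient (PreD Q hβ)

/-- The element of `𝓓_β` given by a process. -/
noncomputable def DSpace.of (Q : QuadraticVariation P F T M) {β : ℝ} (hβ : 1 < β) (X : ℝ → Ω → ℝ)
    (hX : X ∈ processSpace Q hβ) : DSpace Q hβ :=
  SeparationQuotient.mk (show PreD Q hβ from ⟨X, hX⟩)

theorem DSpace.norm_of (Q : QuadraticVariation P F T M) {β : ℝ} (hβ : 1 < β) (X : ℝ → Ω → ℝ)
    (hX : X ∈ processSpace Q hβ) :
    ‖DSpace.of Q hβ X hX‖ = ((∫⁻ ω, energy Q X ω ^ β ∂P) ^ (1 / (2 * β))).toReal :=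
  rfl

end Space

end FracOU

namespace FracOU

/-! ### The Mandelbrot–Van Ness kernel and its derivatives in the Hurst parameter -/

/-! Integration by parts turns the pathwise Riemann–Stieltjes integral into a Lebesgue integral:
`ornsteinUhlenbeck α lam0 Z` equals `exp (-α t) (lam0 - Z 0) + derivProcess α Z`, where
`derivProcess α` is a linear Volterra operator (`ornsteinUhlenbeck_eq`). Since `lam0` does not
depend on `H` and `B^H_0 = 0` almost surely, the first order remainder of `H ↦ λ^H` is `derivProcess
α R` with `R = B^h - B^H - (h - H) Y`, and each `R_t` is the Wiener integral of the first order
remainder of the kernel.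

Three estimates then suffice. The process `M` is a Brownian motion, so `d⟨M⟩` is almost surely
Lebesgue measure on `(0, T]` (`QuadraticVariation.ae_clock_eq`), and by Cauchy–Schwarz `derivProcess
α` is bounded for the norm of `𝓓_β` (`betaNorm_derivProcess_le`). Moments of Wiener integrals are
controlled by the `L²(ℝ)` norm of the integrand, because the `L^p` norms of centred Gaussian
variables are all proportional (`IsWienerIntegral.eLpNorm_le`); with Hölder and Tonelli the norm of
`R` is at most a constant times the supremum over `t` of the `L²(ℝ)` norm of the kernel remainder
(`betaNorm_le_of_isWienerIntegral`). Finally that remainder is `o(h - H)` in `L²(ℝ)`, uniformly in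
`t ∈ [0, T]` (`eLpNorm_kernel_sub_le`): for `h` in a compact subinterval of `(0, 1)` the
unnormalised kernel and its first two derivatives in `h` are dominated by a multiple of
`kernelBound`, whose `L²` norm is bounded independently of `t`, and the normalising constant is
differentiable by differentiation under the integral sign.

The progressive version of `Y` is a limsup of difference quotients of `H ↦ B^H` along a sequence of
increments chosen so small that the quotients converge almost surely at every `t`. The quotients are
continuous and adapted, hence progressive. -/

/-- The function `x ↦ x₊ ^ a (log x)^k`, the `k`-th derivative of `posPow x a` in `a`. -/
noncomputable def logPow (k : ℕ) (x a : ℝ) : ℝ := if 0 < x then x ^ a * Real.log x ^ k else 0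

/-- The `k`-th derivative in `h` of the unnormalised kernel. -/
noncomputable def rawKernel (k : ℕ) (h t s : ℝ) : ℝ :=
  logPow k (t - s) (h - 1 / 2) - logPow k (-s) (h - 1 / 2)

theorem logPow_of_pos {x : ℝ} (hx : 0 < x) (k : ℕ) (a : ℝ) :
    logPow k x a = x ^ a * Real.log x ^ k := if_pos hx

theorem logPow_of_nonpos {x : ℝ} (hx : x ≤ 0) (k : ℕ) (a : ℝ) : logPow k x a = 0 :=
  if_neg hx.not_gt

theorem kernel_eq (h t s : ℝ) : kernel h t s = normConst h * rawKernel 0 h t s := by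
  simp [kernel, rawKernel, logPow, posPow]

theorem hasDerivAt_logPow (k : ℕ) (x a : ℝ) :
    HasDerivAt (fun a => logPow k x a) (logPow (k + 1) x a) a := by
  rcases lt_or_ge 0 x with hx | hx
  · simp only [logPow_of_pos hx]
    have h := ((hasDerivAt_id a).const_rpow hx).mul_const (Real.log x ^ k)
    exact h.congr_deriv (by simp only [id]; ring)
  · simp only [logPow_of_nonpos hx]
    exact hasDerivAt_const _ _

theorem hasDerivAt_rawKernel (k : ℕ) (h t s : ℝ) :
    HasDerivAt (fun h => rawKernel k h t s) (rawKernel (k + 1) h t s) h := by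
  have e : ∀ x, HasDerivAt (fun h => logPow k x (h - 1 / 2)) (logPow (k + 1) x (h - 1 / 2)) h := by
    intro x
    have h1 := (hasDerivAt_logPow k x (h - 1 / 2)).comp h ((hasDerivAt_id h).sub_const (1 / 2))
    rw [mul_one] at h1
    exact h1
  exact (e _).sub (e _)

theorem measurable_logPow (k : ℕ) (a : ℝ) : Measurable fun x => logPow k x a := by
  unfold logPow
  exact Measurable.ite measurableSet_Ioi (by fun_prop) measurable_const

theorem measurable_rawKernel (k : ℕ) (h t : ℝ) : Measurable (rawKernel k h t) :=
  ((measurable_logPow k _).comp (measurable_const.sub measurable_id)).sub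
    ((measurable_logPow k _).comp measurable_neg)

theorem rawKernel_of_le (k : ℕ) (h : ℝ) {t s : ℝ} (ht : 0 ≤ t) (hs : t ≤ s) :
    rawKernel k h t s = 0 := by
  rw [rawKernel, logPow_of_nonpos (by linarith), logPow_of_nonpos (by linarith), sub_zero]

/-! ### Domination of the kernels -/

/-- Each logarithm costs an arbitrarily small power of `x`. The exponent `h - 1/2 ≥ a - 1/2` leaves
room `a/2` for all `k` of them, and what remains, `a/2 - 1/2 > -1/2`, is square integrable at `0`.
-/
theorem exists_abs_logPow_le {a b R : ℝ} (ha : 0 < a) (hb : b < 1) (hR : 1 ≤ R) (k : ℕ) :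
    ∃ C, 0 ≤ C ∧ ∀ h ∈ Icc a b, ∀ x ∈ Ioc 0 R,
      |logPow k x (h - 1 / 2)| ≤ C * x ^ (a / 2 - 1 / 2) := by
  -- Chosen so that `δ * k ≤ a / 2`; the `k + 1` keeps the quotient meaningful for `k = 0`.
  set δ : ℝ := a / (2 * (k + 1)) with hδ
  have hδ0 : 0 < δ := by positivity
  have hδk : δ * k ≤ a / 2 := by
    rw [hδ, div_mul_eq_mul_div, div_le_div_iff₀ (by positivity) two_pos]
    nlinarith [(Nat.cast_nonneg k : (0 : ℝ) ≤ k)]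
  refine ⟨((R ^ (2 * δ) + 1) / δ) ^ k * R, by positivity, fun h hh x hx => ?_⟩
  have hx0 := hx.1
  -- The bound `log y ≤ y ^ δ / δ` is used at `x` and at `x⁻¹`; on `(0, R]` the positive power is
  -- absorbed through `x ^ δ ≤ R ^ (2δ) x ^ (-δ)`.
  have hlog : |Real.log x| ≤ (R ^ (2 * δ) + 1) / δ * x ^ (-δ) := by
    have h1 : Real.log x ≤ x ^ δ / δ := Real.log_le_rpow_div hx0.le hδ0
    have h2 : -Real.log x ≤ x ^ (-δ) / δ := by
      have := Real.log_le_rpow_div (inv_pos.2 hx0).le hδ0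
      rwa [Real.log_inv, Real.inv_rpow hx0.le, ← Real.rpow_neg hx0.le] at this
    have h3 : x ^ δ ≤ R ^ (2 * δ) * x ^ (-δ) := by
      have : x ^ δ = x ^ (2 * δ) * x ^ (-δ) := by
        rw [← Real.rpow_add hx0]
        ring_nf
      rw [this]
      gcongr
      exact hx.2
    have h4 : 0 ≤ x ^ (-δ) := by positivity
    have h5 : 0 ≤ R ^ (2 * δ) * x ^ (-δ) := by positivity
    rw [div_mul_eq_mul_div, abs_le]
    constructor
    · rw [neg_le]
      refine h2.trans ?_
      gcongr
      nlinarith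
    · refine h1.trans ?_
      gcongr
      nlinarith
  rw [logPow_of_pos hx0, abs_mul, abs_pow, abs_of_pos (by positivity : 0 < x ^ (h - 1 / 2))]
  have h6 : |Real.log x| ^ k ≤ ((R ^ (2 * δ) + 1) / δ) ^ k * x ^ (-(δ * k)) := by
    refine (pow_le_pow_left₀ (abs_nonneg _) hlog k).trans_eq ?_
    rw [mul_pow, ← Real.rpow_natCast (x ^ (-δ)), ← Real.rpow_mul hx0.le, neg_mul]
  have h7 : x ^ (h - 1 / 2) * x ^ (-(δ * k)) ≤ R * x ^ (a / 2 - 1 / 2) := by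
    rw [← Real.rpow_add hx0]
    have e : h - 1 / 2 + -(δ * k) = (h - a / 2 - δ * k) + (a / 2 - 1 / 2) := by ring
    rw [e, Real.rpow_add hx0]
    gcongr
    have h8 : 0 ≤ h - a / 2 - δ * k := by linarith [hh.1]
    calc x ^ (h - a / 2 - δ * k) ≤ R ^ (h - a / 2 - δ * k) :=
          Real.rpow_le_rpow hx0.le hx.2 h8
      _ ≤ R ^ (1 : ℝ) := by
          apply Real.rpow_le_rpow_of_exponent_le hR
          have : 0 ≤ δ * k := by positivity
          linarith [hh.2]
      _ = R := Real.rpow_one R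
  calc x ^ (h - 1 / 2) * |Real.log x| ^ k
      ≤ x ^ (h - 1 / 2) * (((R ^ (2 * δ) + 1) / δ) ^ k * x ^ (-(δ * k))) := by gcongr
    _ = ((R ^ (2 * δ) + 1) / δ) ^ k * (x ^ (h - 1 / 2) * x ^ (-(δ * k))) := by ring
    _ ≤ ((R ^ (2 * δ) + 1) / δ) ^ k * (R * x ^ (a / 2 - 1 / 2)) := by gcongr
    _ = _ := by ring

/-- The two terms separately need not be square integrable at infinity, but their difference gains
one power by the mean value inequality: the derivative is of order `z ^ (h - 3/2)` up to logarithms.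
The logarithms cost at most `(1 - b)/2` in the exponent, which moves `b` to the midpoint `(1 + b)/2
< 1`, so the final exponent stays below `-1/2`. -/
theorem exists_abs_logPow_sub_le {a b T : ℝ} (ha : 0 < a) (hb : b < 1) (hT : 0 ≤ T) (k : ℕ) :
    ∃ C, 0 ≤ C ∧ ∀ h ∈ Icc a b, ∀ t ∈ Icc 0 T, ∀ y, 1 ≤ y →
      |logPow k (t + y) (h - 1 / 2) - logPow k y (h - 1 / 2)| ≤ C * y ^ ((1 + b) / 2 - 3 / 2) := by
  set ε : ℝ := (1 - b) / (2 * (k + 1)) with hε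
  have hε0 : 0 < ε := div_pos (by linarith) (by positivity)
  have hεk : ε * k ≤ (1 - b) / 2 := by
    rw [hε, div_mul_eq_mul_div, div_le_div_iff₀ (by positivity) two_pos]
    nlinarith [(Nat.cast_nonneg k : (0 : ℝ) ≤ k)]
  refine ⟨(1 + k) * (1 + 1 / ε) ^ k * T, by positivity, fun h hh t ht y hy => ?_⟩
  -- For `k = 0` the truncated exponent `k - 1` is harmless, since its term carries the factor `k`.
  have hder : ∀ z, 1 ≤ z → HasDerivAt (fun z => logPow k z (h - 1 / 2))
      ((h - 1 / 2) * z ^ (h - 1 / 2 - 1) * Real.log z ^ k +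
        z ^ (h - 1 / 2) * (k * Real.log z ^ (k - 1) * z⁻¹)) z := by
    intro z hz
    have hz0 : 0 < z := by linarith
    have h1 := (Real.hasDerivAt_rpow_const (p := h - 1 / 2) (Or.inl hz0.ne')).mul
      ((Real.hasDerivAt_log hz0.ne').pow k)
    refine h1.congr_of_eventuallyEq ?_
    filter_upwards [lt_mem_nhds hz0] with w hw
    simp [logPow_of_pos hw]
  have hbound : ∀ z, y ≤ z → ‖(h - 1 / 2) * z ^ (h - 1 / 2 - 1) * Real.log z ^ k +
        z ^ (h - 1 / 2) * (k * Real.log z ^ (k - 1) * z⁻¹)‖ ≤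
        (1 + k) * (1 + 1 / ε) ^ k * y ^ ((1 + b) / 2 - 3 / 2) := by
    intro z hyz
    have hz : 1 ≤ z := hy.trans hyz
    have hz0 : 0 < z := by linarith
    have hl0 : 0 ≤ Real.log z := Real.log_nonneg hz
    have hzε : 1 ≤ z ^ ε := Real.one_le_rpow hz hε0.le
    -- Working with `1 + log z ≥ 1` lets the power `k` dominate the power `k - 1` as well.
    have hl : 1 + Real.log z ≤ (1 + 1 / ε) * z ^ ε := by
      have := Real.log_le_rpow_div hz0.le hε0
      calc 1 + Real.log z ≤ z ^ ε + z ^ ε / ε := add_le_add hzε this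
        _ = _ := by ring
    have hlk : (1 + Real.log z) ^ k ≤ (1 + 1 / ε) ^ k * z ^ (ε * k) := by
      refine (pow_le_pow_left₀ (by positivity) hl k).trans_eq ?_
      rw [mul_pow, ← Real.rpow_natCast (z ^ ε), ← Real.rpow_mul hz0.le]
    have hk1 : Real.log z ^ k ≤ (1 + Real.log z) ^ k := pow_le_pow_left₀ hl0 (by linarith) k
    have hk2 : Real.log z ^ (k - 1) ≤ (1 + Real.log z) ^ k :=
      (pow_le_pow_left₀ hl0 (by linarith) (k - 1)).trans
        (pow_le_pow_right₀ (by linarith) (Nat.sub_le k 1))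
    have hp : |h - 1 / 2| ≤ 1 := abs_le.2 ⟨by linarith [hh.1], by linarith [hh.2]⟩
    have e : z ^ (h - 1 / 2) * (k * Real.log z ^ (k - 1) * z⁻¹) =
        z ^ (h - 1 / 2 - 1) * (k * Real.log z ^ (k - 1)) := by
      rw [Real.rpow_sub_one hz0.ne']
      ring
    rw [e, Real.norm_eq_abs]
    have hzp : 0 < z ^ (h - 1 / 2 - 1) := by positivity
    calc |(h - 1 / 2) * z ^ (h - 1 / 2 - 1) * Real.log z ^ k +
          z ^ (h - 1 / 2 - 1) * (k * Real.log z ^ (k - 1))|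
        ≤ |(h - 1 / 2) * z ^ (h - 1 / 2 - 1) * Real.log z ^ k| +
          |z ^ (h - 1 / 2 - 1) * (k * Real.log z ^ (k - 1))| := abs_add_le _ _
      _ = |h - 1 / 2| * z ^ (h - 1 / 2 - 1) * Real.log z ^ k +
          z ^ (h - 1 / 2 - 1) * (k * Real.log z ^ (k - 1)) := by
          rw [abs_mul, abs_mul, abs_of_pos hzp, abs_of_nonneg (pow_nonneg hl0 k),
            abs_of_nonneg (by positivity : 0 ≤ z ^ (h - 1 / 2 - 1) * (k * Real.log z ^ (k - 1)))]
      _ ≤ 1 * z ^ (h - 1 / 2 - 1) * (1 + Real.log z) ^ k +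
          z ^ (h - 1 / 2 - 1) * (k * (1 + Real.log z) ^ k) := by gcongr
      _ = (1 + k) * (z ^ (h - 1 / 2 - 1) * (1 + Real.log z) ^ k) := by ring
      _ ≤ (1 + k) * (z ^ (h - 1 / 2 - 1) * ((1 + 1 / ε) ^ k * z ^ (ε * k))) := by gcongr
      _ = (1 + k) * (1 + 1 / ε) ^ k * (z ^ (h - 1 / 2 - 1) * z ^ (ε * k)) := by ring
      _ ≤ (1 + k) * (1 + 1 / ε) ^ k * z ^ ((1 + b) / 2 - 3 / 2) := by
          gcongr
          rw [← Real.rpow_add hz0]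
          exact Real.rpow_le_rpow_of_exponent_le hz (by linarith [hh.2])
      _ ≤ (1 + k) * (1 + 1 / ε) ^ k * y ^ ((1 + b) / 2 - 3 / 2) := by
          refine mul_le_mul_of_nonneg_left ?_ (by positivity)
          exact Real.rpow_le_rpow_of_nonpos (by linarith) hyz (by linarith)
  have h := (convex_Ici y).norm_image_sub_le_of_norm_hasDerivWithin_le (x := y) (y := t + y)
    (f := fun z => logPow k z (h - 1 / 2)) (fun z hz => (hder z (hy.trans hz)).hasDerivWithinAt)
    hbound (mem_Ici.2 le_rfl) (mem_Ici.2 (by linarith [ht.1]))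
  rw [Real.norm_eq_abs, add_sub_cancel_right, Real.norm_eq_abs, abs_of_nonneg ht.1] at h
  refine h.trans ?_
  calc (1 + k) * (1 + 1 / ε) ^ k * y ^ ((1 + b) / 2 - 3 / 2) * t
      ≤ (1 + k) * (1 + 1 / ε) ^ k * y ^ ((1 + b) / 2 - 3 / 2) * T := by
        gcongr
        exact ht.2
    _ = _ := by ring

/-- A square integrable function which dominates the kernels near `0`. -/
noncomputable def nearBound (a T x : ℝ) : ℝ :=
  (Ioc 0 (T + 1)).indicator (fun x => x ^ (a / 2 - 1 / 2)) x

/-- A square integrable function which dominates the kernels near `-∞`. -/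
noncomputable def farBound (b y : ℝ) : ℝ :=
  (Ioi 1).indicator (fun y => y ^ ((1 + b) / 2 - 3 / 2)) y

/-- A function which dominates the kernels `rawKernel k h t`, `h ∈ [a, b]`, `k ≤ 2`. -/
noncomputable def kernelBound (a b T t s : ℝ) : ℝ :=
  nearBound a T (t - s) + nearBound a T (-s) + farBound b (-s)

theorem nearBound_nonneg (a T x : ℝ) : 0 ≤ nearBound a T x :=
  indicator_nonneg (fun _ hx => Real.rpow_nonneg hx.1.le _) x

theorem farBound_nonneg (b y : ℝ) : 0 ≤ farBound b y :=
  indicator_nonneg (fun _ hx => Real.rpow_nonneg (zero_le_one.trans (mem_Ioi.1 hx).le) _) y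

theorem kernelBound_nonneg (a b T t s : ℝ) : 0 ≤ kernelBound a b T t s :=
  add_nonneg (add_nonneg (nearBound_nonneg _ _ _) (nearBound_nonneg _ _ _)) (farBound_nonneg _ _)

/-- Four regions of `s`: for `s ≥ t` the kernel vanishes, for `0 ≤ s < t` only the singularity at
`t` is present, for `-1 ≤ s < 0` the two singular terms are bounded separately, and for `s < -1` the
cancellation between them is needed. -/
theorem exists_abs_rawKernel_le_of_index {a b T : ℝ} (ha : 0 < a) (hb : b < 1) (hT : 0 ≤ T)
    (k : ℕ) : ∃ C, 0 ≤ C ∧ ∀ h ∈ Icc a b, ∀ t ∈ Icc 0 T, ∀ s,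
      |rawKernel k h t s| ≤ C * kernelBound a b T t s := by
  obtain ⟨C1, hC1, h1⟩ := exists_abs_logPow_le ha hb (by linarith : 1 ≤ T + 1) k
  obtain ⟨C2, hC2, h2⟩ := exists_abs_logPow_sub_le ha hb hT k
  refine ⟨C1 + C2, by positivity, fun h hh t ht s => ?_⟩
  have hn : ∀ x ∈ Ioc 0 (T + 1), |logPow k x (h - 1 / 2)| ≤ C1 * nearBound a T x := by
    intro x hx
    rw [nearBound, indicator_of_mem hx]
    exact h1 h hh x hx
  have n1 := nearBound_nonneg a T (t - s)
  have n2 := nearBound_nonneg a T (-s)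
  have n3 := farBound_nonneg b (-s)
  have n4 := kernelBound_nonneg a b T t s
  rcases le_or_gt t s with hts | hts
  · rw [rawKernel_of_le k h ht.1 hts, abs_zero]
    positivity
  rcases le_or_gt 0 s with hs | hs
  · rw [rawKernel, logPow_of_nonpos (by linarith : -s ≤ 0), sub_zero]
    refine (hn _ ⟨by linarith, by linarith [ht.2]⟩).trans ?_
    rw [kernelBound]
    nlinarith
  rcases le_or_gt (-1) s with hs1 | hs1
  · rw [rawKernel]
    refine (abs_sub _ _).trans ((add_le_add (hn _ ⟨by linarith, by linarith [ht.2]⟩)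
      (hn _ ⟨by linarith, by linarith⟩)).trans ?_)
    rw [kernelBound]
    nlinarith
  · have h3 := h2 h hh t ht (-s) (by linarith)
    have h4 : farBound b (-s) = (-s) ^ ((1 + b) / 2 - 3 / 2) :=
      indicator_of_mem (mem_Ioi.2 (by linarith)) _
    rw [← h4] at h3
    rw [rawKernel, sub_eq_add_neg t s]
    refine h3.trans ?_
    rw [kernelBound]
    nlinarith

theorem exists_abs_rawKernel_le {a b T : ℝ} (ha : 0 < a) (hb : b < 1) (hT : 0 ≤ T) :
    ∃ C, 0 ≤ C ∧ ∀ k ≤ 2, ∀ h ∈ Icc a b, ∀ t ∈ Icc 0 T, ∀ s,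
      |rawKernel k h t s| ≤ C * kernelBound a b T t s := by
  choose C hC h using exists_abs_rawKernel_le_of_index ha hb hT
  refine ⟨C 0 + C 1 + C 2, by linarith [hC 0, hC 1, hC 2], fun k hk x hx t ht s => ?_⟩
  refine (h k x hx t ht s).trans (mul_le_mul_of_nonneg_right ?_ (kernelBound_nonneg _ _ _ _ _))
  interval_cases k <;> linarith [hC 0, hC 1, hC 2]

/-! ### Square integrability of the dominating functions -/

theorem memLp_nearBound {a : ℝ} (ha : 0 < a) (T : ℝ) :
    MemLp (nearBound a T) 2 volume := by
  have hm : Measurable (nearBound a T) :=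
    Measurable.indicator (by fun_prop) measurableSet_Ioc
  rw [memLp_two_iff_integrable_sq hm.aestronglyMeasurable]
  have h1 : IntegrableOn (fun x : ℝ => x ^ (a - 1)) (Ioc 0 (T + 1)) :=
    (intervalIntegral.intervalIntegrable_rpow' (by linarith : -1 < a - 1)).1
  refine (h1.integrable_indicator measurableSet_Ioc).congr (Eventually.of_forall fun x => ?_)
  by_cases hx : x ∈ Ioc 0 (T + 1)
  · simp only [nearBound, indicator_of_mem hx]
    rw [← Real.rpow_natCast, ← Real.rpow_mul hx.1.le]
    push_cast
    ring_nf
  · simp [nearBound, indicator_of_notMem hx]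

theorem memLp_farBound {b : ℝ} (hb : b < 1) : MemLp (farBound b) 2 volume := by
  have hm : Measurable (farBound b) := Measurable.indicator (by fun_prop) measurableSet_Ioi
  rw [memLp_two_iff_integrable_sq hm.aestronglyMeasurable]
  have h1 : IntegrableOn (fun x : ℝ => x ^ (b - 2)) (Ioi 1) :=
    integrableOn_Ioi_rpow_of_lt (by linarith) one_pos
  refine (h1.integrable_indicator measurableSet_Ioi).congr (Eventually.of_forall fun x => ?_)
  by_cases hx : x ∈ Ioi (1 : ℝ)
  · simp only [farBound, indicator_of_mem hx]
    rw [← Real.rpow_natCast, ← Real.rpow_mul (zero_le_one.trans (mem_Ioi.1 hx).le)]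
    push_cast
    ring_nf
  · simp [farBound, indicator_of_notMem hx]

theorem measurable_kernelBound (a b T t : ℝ) : Measurable (kernelBound a b T t) := by
  have h1 : Measurable (nearBound a T) := Measurable.indicator (by fun_prop) measurableSet_Ioc
  have h2 : Measurable (farBound b) := Measurable.indicator (by fun_prop) measurableSet_Ioi
  exact ((h1.comp (measurable_const.sub measurable_id)).add (h1.comp measurable_neg)).add
    (h2.comp measurable_neg)

/-- The variable `t` enters only through the translate `t - s`, and Lebesgue measure is invariant
under translation and reflection. This is the source of all uniformity in `t`. -/
theorem exists_eLpNorm_kernelBound_le {a b : ℝ} (ha : 0 < a) (hb : b < 1) (T : ℝ) :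
    ∃ A : ℝ≥0, ∀ t, eLpNorm (kernelBound a b T t) 2 volume ≤ A := by
  have hn := memLp_nearBound ha T
  have hf := memLp_farBound hb
  have hlt : eLpNorm (nearBound a T) 2 volume + eLpNorm (nearBound a T) 2 volume +
      eLpNorm (farBound b) 2 volume < ∞ :=
    ENNReal.add_lt_top.2 ⟨ENNReal.add_lt_top.2 ⟨hn.2, hn.2⟩, hf.2⟩
  refine ⟨_, fun t => le_trans ?_ (ENNReal.coe_toNNReal hlt.ne).ge⟩
  have m1 := Measure.measurePreserving_sub_left (volume : Measure ℝ) t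
  have m2 := Measure.measurePreserving_neg (volume : Measure ℝ)
  have e1 := eLpNorm_comp_measurePreserving (p := 2) hn.1 m1
  have e2 := eLpNorm_comp_measurePreserving (p := 2) hn.1 m2
  have e3 := eLpNorm_comp_measurePreserving (p := 2) hf.1 m2
  have n1 := hn.comp_measurePreserving m1
  have n2 := hn.comp_measurePreserving m2
  have n3 := hf.comp_measurePreserving m2
  have h1 := eLpNorm_add_le (n1.1.add n2.1) n3.1 one_le_two
  have h2 := eLpNorm_add_le n1.1 n2.1 one_le_two
  rw [e1, e2] at h2
  rw [e3] at h1
  exact h1.trans (add_le_add h2 le_rfl)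

theorem memLp_kernelBound {a b : ℝ} (ha : 0 < a) (hb : b < 1) (T t : ℝ) :
    MemLp (kernelBound a b T t) 2 volume := by
  obtain ⟨A, hA⟩ := exists_eLpNorm_kernelBound_le ha hb T
  exact ⟨(measurable_kernelBound a b T t).aestronglyMeasurable,
    (hA t).trans_lt ENNReal.coe_lt_top⟩

/-! ### Differentiability of the normalising constant and Taylor expansion of the kernel -/

/-- Differentiation under the integral sign, with the square of `kernelBound` as majorant on a
compact neighbourhood of `H`. Only the existence of the derivative matters; its value plays no role
later. -/
theorem exists_hasDerivAt_normConst {H : ℝ} (hH : H ∈ Ioo (0 : ℝ) 1) :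
    ∃ c, HasDerivAt normConst c H := by
  obtain ⟨a, ha, haH⟩ := exists_between hH.1
  obtain ⟨b, hHb, hb⟩ := exists_between hH.2
  obtain ⟨C, hC, hbd⟩ := exists_abs_rawKernel_le ha hb zero_le_one
  have hmem : ∀ h ∈ Ioo a b, h ∈ Icc a b := fun h hh => ⟨hh.1.le, hh.2.le⟩
  have h1 : (1 : ℝ) ∈ Icc (0 : ℝ) 1 := ⟨zero_le_one, le_rfl⟩
  have hD : Integrable (fun s => kernelBound a b 1 1 (-s) ^ 2)
      (volume.restrict (Ioi (0 : ℝ))) :=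
    (((memLp_kernelBound ha hb 1 1).comp_measurePreserving
      (Measure.measurePreserving_neg volume)).integrable_sq).integrableOn
  have hm : ∀ k h, Measurable fun s => rawKernel k h 1 (-s) := fun k h =>
    (measurable_rawKernel k h 1).comp measurable_neg
  have hsq : ∀ h ∈ Icc a b, ∀ k ≤ 2, ∀ l ≤ 2, ∀ s,
      |rawKernel k h 1 s * rawKernel l h 1 s| ≤ C ^ 2 * kernelBound a b 1 1 s ^ 2 := by
    intro h hh k hk l hl s
    rw [abs_mul]
    have := mul_le_mul (hbd k hk h hh 1 h1 s) (hbd l hl h hh 1 h1 s) (abs_nonneg _)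
      (mul_nonneg hC (kernelBound_nonneg _ _ _ _ _))
    linarith
  have key := hasDerivAt_integral_of_dominated_loc_of_deriv_le
    (μ := volume.restrict (Ioi (0 : ℝ))) (F := fun h s => rawKernel 0 h 1 (-s) ^ 2)
    (F' := fun h s => 2 * (rawKernel 0 h 1 (-s) * rawKernel 1 h 1 (-s))) (x₀ := H)
    (s := Ioo a b) (bound := fun s => 2 * (C ^ 2 * kernelBound a b 1 1 (-s) ^ 2))
    (Ioo_mem_nhds haH hHb)
    (Eventually.of_forall fun h => ((hm 0 h).pow_const 2).aestronglyMeasurable)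
    ((hD.const_mul (C ^ 2)).mono' ((hm 0 H).pow_const 2).aestronglyMeasurable
      (Eventually.of_forall fun s => by
        have := hsq H ⟨haH.le, hHb.le⟩ 0 (by norm_num) 0 (by norm_num) (-s)
        rwa [← sq] at this))
    (((hm 0 H).mul (hm 1 H)).const_mul 2).aestronglyMeasurable
    (Eventually.of_forall fun s h hh => by
      rw [norm_mul, Real.norm_eq_abs, Real.norm_eq_abs, abs_two]
      exact mul_le_mul_of_nonneg_left
        (hsq h (hmem h hh) 0 (by norm_num) 1 (by norm_num) (-s)) two_pos.le)
    ((hD.const_mul _).const_mul 2)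
    (Eventually.of_forall fun s h _ => by
      have := (hasDerivAt_rawKernel 0 h 1 (-s)).pow 2
      exact this.congr_deriv (by push_cast; ring))
  -- The integral in the normalising constant is the squared `L²` norm of the kernel at `t = 1` over
  -- the negative half-line, so the same domination applies.
  have hJ : ∀ h, (∫ s in Ioi (0 : ℝ), ((1 + s) ^ (h - 1 / 2) - s ^ (h - 1 / 2)) ^ 2) =
      ∫ s in Ioi (0 : ℝ), rawKernel 0 h 1 (-s) ^ 2 := by
    intro h
    refine setIntegral_congr_fun measurableSet_Ioi fun s hs => ?_
    have hs0 : 0 < s := hs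
    simp only [rawKernel]
    rw [logPow_of_pos (by linarith), logPow_of_pos (by linarith)]
    simp
  have hpos : (∫ s in Ioi (0 : ℝ), rawKernel 0 H 1 (-s) ^ 2) + 1 / (2 * H) ≠ 0 := by
    have h2 : 0 ≤ ∫ s in Ioi (0 : ℝ), rawKernel 0 H 1 (-s) ^ 2 :=
      integral_nonneg fun s => sq_nonneg _
    have h3 : 0 < 1 / (2 * H) := by have := hH.1; positivity
    linarith [h2, h3] |> fun h : 0 < _ => h.ne'
  have h4 : HasDerivAt (fun h : ℝ => 1 / (2 * h)) (-(2 * 1) / (2 * H) ^ 2) H := by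
    have := (((hasDerivAt_id H).const_mul 2)).inv (by have := hH.1; simp; linarith)
    simp only [one_div]
    exact this
  have h5 := (key.2.add h4).rpow_const (p := (-(1 / 2) : ℝ)) (Or.inl hpos)
  refine ⟨_, h5.congr_of_eventuallyEq (Eventually.of_forall fun h => ?_)⟩
  rw [normConst, hJ h]
  rfl

/-- The mean value inequality applied twice, first to `f'` and then to `f x - x f'(H)`; the constant
is not the optimal `M / 2`, which is immaterial here. -/
theorem abs_sub_sub_le_of_hasDerivAt_two {f f' f'' : ℝ → ℝ} {M H h a b : ℝ}
    (hf : ∀ x, HasDerivAt f (f' x) x) (hf' : ∀ x, HasDerivAt f' (f'' x) x)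
    (hM : ∀ x ∈ Icc a b, |f'' x| ≤ M) (hH : H ∈ Icc a b) (hh : h ∈ Icc a b) :
    |f h - f H - (h - H) * f' H| ≤ M * (h - H) ^ 2 := by
  have hM0 : 0 ≤ M := (abs_nonneg _).trans (hM H hH)
  have hsub : uIcc H h ⊆ Icc a b := uIcc_subset_Icc hH hh
  have h1 : ∀ x ∈ uIcc H h, ‖f' x - f' H‖ ≤ M * |h - H| := by
    intro x hx
    have := (convex_uIcc H h).norm_image_sub_le_of_norm_hasDerivWithin_le
      (fun y _ => (hf' y).hasDerivWithinAt) (fun y hy => hM y (hsub hy)) left_mem_uIcc hx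
    refine this.trans (mul_le_mul_of_nonneg_left ?_ hM0)
    exact abs_sub_left_of_mem_uIcc hx
  have h2 := (convex_uIcc H h).norm_image_sub_le_of_norm_hasDerivWithin_le
    (f := fun x => f x - x * f' H)
    (fun y _ => by
      have := ((hf y).sub ((hasDerivAt_id y).mul_const (f' H))).hasDerivWithinAt (s := uIcc H h)
      rw [one_mul] at this
      exact this) h1 left_mem_uIcc right_mem_uIcc
  rw [Real.norm_eq_abs, Real.norm_eq_abs, mul_assoc, ← sq, sq_abs] at h2
  convert h2 using 2
  ring

theorem hasDerivAt_kernel {H : ℝ} (hH : H ∈ Ioo (0 : ℝ) 1) (t s : ℝ) :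
    HasDerivAt (fun h => kernel h t s) (kernelDeriv H t s) H := by
  obtain ⟨c, hc⟩ := exists_hasDerivAt_normConst hH
  have := hc.mul (hasDerivAt_rawKernel 0 H t s)
  exact (this.congr_of_eventuallyEq
    (Eventually.of_forall fun h => kernel_eq h t s)).differentiableAt.hasDerivAt

theorem kernelDeriv_eq {H : ℝ} (hH : H ∈ Ioo (0 : ℝ) 1) (t s : ℝ) :
    kernelDeriv H t s =
      deriv normConst H * rawKernel 0 H t s + normConst H * rawKernel 1 H t s := by
  obtain ⟨c, hc⟩ := exists_hasDerivAt_normConst hH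
  have := hc.mul (hasDerivAt_rawKernel 0 H t s)
  rw [hc.deriv]
  exact (hasDerivAt_kernel hH t s).unique
    (this.congr_of_eventuallyEq (Eventually.of_forall fun h => kernel_eq h t s))

theorem measurable_kernelDeriv {H : ℝ} (hH : H ∈ Ioo (0 : ℝ) 1) (t : ℝ) :
    Measurable (kernelDeriv H t) := by
  have : kernelDeriv H t = fun s =>
      deriv normConst H * rawKernel 0 H t s + normConst H * rawKernel 1 H t s :=
    funext fun s => kernelDeriv_eq hH t s
  rw [this]
  exact ((measurable_rawKernel 0 H t).const_mul _).add ((measurable_rawKernel 1 H t).const_mul _)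

theorem kernel_of_le (h : ℝ) {t s : ℝ} (ht : 0 ≤ t) (hs : t ≤ s) : kernel h t s = 0 := by
  rw [kernel_eq, rawKernel_of_le 0 h ht hs, mul_zero]

theorem eLpNorm_le_of_abs_le_kernelBound {a b T t c : ℝ} {A : ℝ≥0} {f : ℝ → ℝ} (hc : 0 ≤ c)
    (hA : eLpNorm (kernelBound a b T t) 2 volume ≤ A)
    (hf : ∀ s, |f s| ≤ c * kernelBound a b T t s) :
    eLpNorm f 2 volume ≤ ENNReal.ofReal (c * A) := by
  have h1 : eLpNorm f 2 volume ≤ eLpNorm (c • kernelBound a b T t) 2 volume := by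
    refine eLpNorm_mono fun s => ?_
    rw [Real.norm_eq_abs, Real.norm_eq_abs]
    exact (hf s).trans (le_abs_self _)
  rw [eLpNorm_const_smul, Real.enorm_of_nonneg hc] at h1
  refine h1.trans ?_
  rw [ENNReal.ofReal_mul hc, ENNReal.ofReal_coe_nnreal]
  gcongr

/-- The Mandelbrot–Van Ness kernel is differentiable in `H` as a map into `L²(ℝ)`, uniformly in
`t ∈ [0, T]`. -/
theorem eLpNorm_kernel_sub_le {H T : ℝ} (hH : H ∈ Ioo (0 : ℝ) 1) (hT : 0 ≤ T) {η : ℝ}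
    (hη : 0 < η) : ∃ δ > 0, ∀ h, |h - H| < δ → ∀ t ∈ Icc 0 T,
      eLpNorm (fun s => kernel h t s - kernel H t s - (h - H) * kernelDeriv H t s) 2 volume ≤
        ENNReal.ofReal (η * |h - H|) := by
  obtain ⟨a, ha, haH⟩ := exists_between hH.1
  obtain ⟨b, hHb, hb⟩ := exists_between hH.2
  obtain ⟨C, hC, hbd⟩ := exists_abs_rawKernel_le ha hb hT
  obtain ⟨A, hA⟩ := exists_eLpNorm_kernelBound_le ha hb T
  obtain ⟨c, hc⟩ := exists_hasDerivAt_normConst hH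
  have hHab : H ∈ Icc a b := ⟨haH.le, hHb.le⟩
  -- The remainder splits into three pieces, each of norm at most `θ C A |h - H|`; the `+ 1` below
  -- guards against `C * A = 0`.
  obtain ⟨θ, hθ0, hθ⟩ : ∃ θ : ℝ, 0 < θ ∧ 3 * θ * C * A ≤ η := by
    refine ⟨η / (3 * C * A + 1), by positivity, ?_⟩
    have : 3 * (η / (3 * C * A + 1)) * C * A = η * ((3 * C * A) / (3 * C * A + 1)) := by ring
    rw [this]
    refine mul_le_of_le_one_right hη.le ((div_le_one (by positivity)).2 (by linarith))
  have e1 : ∀ᶠ h in 𝓝 H, h ∈ Icc a b := Icc_mem_nhds haH hHb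
  have e2 : ∀ᶠ h in 𝓝 H, |normConst h| * |h - H| ≤ θ := by
    have ht : Tendsto (fun h => |normConst h| * |h - H|) (𝓝 H) (𝓝 (|normConst H| * |H - H|)) :=
      hc.continuousAt.abs.mul ((continuousAt_id.sub continuousAt_const).abs)
    rw [sub_self, abs_zero, mul_zero] at ht
    exact ht.eventually (ge_mem_nhds hθ0)
  have e3 : ∀ᶠ h in 𝓝 H, |normConst h - normConst H| ≤ θ := by
    have ht : Tendsto (fun h => |normConst h - normConst H|) (𝓝 H)
        (𝓝 |normConst H - normConst H|) := (hc.continuousAt.sub continuousAt_const).abs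
    rw [sub_self, abs_zero] at ht
    exact ht.eventually (ge_mem_nhds hθ0)
  have e4 : ∀ᶠ h in 𝓝 H, |normConst h - normConst H - (h - H) * c| ≤ θ * |h - H| := by
    have := (hasDerivAt_iff_isLittleO.1 hc).bound hθ0
    simpa only [Real.norm_eq_abs, smul_eq_mul] using this
  obtain ⟨δ, hδ, hball⟩ := Metric.eventually_nhds_iff.1 (e1.and (e2.and (e3.and e4)))
  refine ⟨δ, hδ, fun h hh t ht => ?_⟩
  obtain ⟨i1, i2, i3, i4⟩ := hball (by rwa [Real.dist_eq])
  have main : ∀ s, |kernel h t s - kernel H t s - (h - H) * kernelDeriv H t s| ≤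
      3 * θ * C * |h - H| * kernelBound a b T t s := by
    intro s
    have hD := kernelBound_nonneg a b T t s
    have t1 := abs_sub_sub_le_of_hasDerivAt_two (fun x => hasDerivAt_rawKernel 0 x t s)
      (fun x => hasDerivAt_rawKernel 1 x t s)
      (fun x hx => hbd 2 le_rfl x hx t ht s) hHab i1
    have t2 := hbd 0 (by norm_num) H hHab t ht s
    have t3 := hbd 1 (by norm_num) H hHab t ht s
    rw [kernel_eq, kernel_eq, kernelDeriv_eq hH, hc.deriv]
    set g := rawKernel 0 H t s
    set g' := rawKernel 1 H t s
    set D := kernelBound a b T t s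
    -- Remainder of a product: the Taylor remainder of the raw kernel, that of the constant, and a
    -- cross term. The first is quadratic in `h - H`, and `e2` absorbs one of its two factors.
    have e : normConst h * rawKernel 0 h t s - normConst H * g -
        (h - H) * (c * g + normConst H * g') =
        normConst h * (rawKernel 0 h t s - g - (h - H) * g') +
        ((normConst h - normConst H - (h - H) * c) * g +
          (normConst h - normConst H) * (h - H) * g') := by ring
    rw [e]
    have s1 : |normConst h * (rawKernel 0 h t s - g - (h - H) * g')| ≤ θ * C * |h - H| * D := by
      rw [abs_mul]
      calc |normConst h| * |rawKernel 0 h t s - g - (h - H) * g'|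
          ≤ |normConst h| * (C * D * (h - H) ^ 2) := by gcongr
        _ = (|normConst h| * |h - H|) * (C * |h - H| * D) := by rw [← sq_abs (h - H)]; ring
        _ ≤ θ * (C * |h - H| * D) := by gcongr
        _ = _ := by ring
    have s2 : |(normConst h - normConst H - (h - H) * c) * g| ≤ θ * C * |h - H| * D := by
      rw [abs_mul]
      calc _ ≤ (θ * |h - H|) * (C * D) := by gcongr
        _ = _ := by ring
    have s3 : |(normConst h - normConst H) * (h - H) * g'| ≤ θ * C * |h - H| * D := by
      rw [abs_mul, abs_mul]
      calc _ ≤ (θ * |h - H|) * (C * D) := by gcongr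
        _ = _ := by ring
    calc _ ≤ _ := abs_add_le _ _
      _ ≤ θ * C * |h - H| * D + (θ * C * |h - H| * D + θ * C * |h - H| * D) :=
          add_le_add s1 ((abs_add_le _ _).trans (add_le_add s2 s3))
      _ = _ := by ring
  refine (eLpNorm_le_of_abs_le_kernelBound (by positivity) (hA t) main).trans
    (ENNReal.ofReal_le_ofReal ?_)
  calc 3 * θ * C * |h - H| * A = (3 * θ * C * A) * |h - H| := by ring
    _ ≤ η * |h - H| := by gcongr

theorem exists_eLpNorm_kernelDeriv_le {H T : ℝ} (hH : H ∈ Ioo (0 : ℝ) 1) (hT : 0 ≤ T) :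
    ∃ A : ℝ≥0, ∀ t ∈ Icc 0 T, eLpNorm (kernelDeriv H t) 2 volume ≤ A := by
  obtain ⟨a, ha, haH⟩ := exists_between hH.1
  obtain ⟨b, hHb, hb⟩ := exists_between hH.2
  obtain ⟨C, hC, hbd⟩ := exists_abs_rawKernel_le ha hb hT
  obtain ⟨A, hA⟩ := exists_eLpNorm_kernelBound_le ha hb T
  refine ⟨Real.toNNReal ((|deriv normConst H| + |normConst H|) * C * A), fun t ht => ?_⟩
  refine eLpNorm_le_of_abs_le_kernelBound (by positivity) (hA t) fun s => ?_
  have t2 := hbd 0 (by norm_num) H ⟨haH.le, hHb.le⟩ t ht s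
  have t3 := hbd 1 (by norm_num) H ⟨haH.le, hHb.le⟩ t ht s
  rw [kernelDeriv_eq hH]
  refine (abs_add_le _ _).trans ?_
  rw [abs_mul, abs_mul]
  calc _ ≤ |deriv normConst H| * (C * kernelBound a b T t s) +
        |normConst H| * (C * kernelBound a b T t s) := by gcongr
    _ = _ := by ring

theorem memLp_kernelDeriv {H t : ℝ} (hH : H ∈ Ioo (0 : ℝ) 1) (ht : 0 ≤ t) :
    MemLp (kernelDeriv H t) 2 volume := by
  obtain ⟨A, hA⟩ := exists_eLpNorm_kernelDeriv_le hH ht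
  exact ⟨(measurable_kernelDeriv hH t).aestronglyMeasurable,
    (hA t ⟨ht, le_rfl⟩).trans_lt ENNReal.coe_lt_top⟩

theorem exists_eLpNorm_kernel_le {H T : ℝ} (hH : H ∈ Ioo (0 : ℝ) 1) (hT : 0 ≤ T) :
    ∃ A : ℝ≥0, ∀ t ∈ Icc 0 T, eLpNorm (kernel H t) 2 volume ≤ A := by
  obtain ⟨C, hC, hbd⟩ := exists_abs_rawKernel_le hH.1 hH.2 hT
  obtain ⟨A, hA⟩ := exists_eLpNorm_kernelBound_le hH.1 hH.2 T
  refine ⟨Real.toNNReal (|normConst H| * C * A), fun t ht => ?_⟩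
  refine eLpNorm_le_of_abs_le_kernelBound (by positivity) (hA t) fun s => ?_
  rw [kernel_eq, abs_mul, mul_assoc]
  exact mul_le_mul_of_nonneg_left (hbd 0 (by norm_num) H ⟨le_rfl, le_rfl⟩ t ht s) (abs_nonneg _)

/-! ### Gaussian moments -/

theorem eLpNorm_two_eq_ofReal_sqrt {X : Type*} {m : MeasurableSpace X} {μ : Measure X} {f : X → ℝ}
    (hf : MemLp f 2 μ) : eLpNorm f 2 μ = ENNReal.ofReal √(∫ x, f x ^ 2 ∂μ) := by
  rw [hf.eLpNorm_eq_integral_rpow_norm two_ne_zero ENNReal.ofNat_ne_top, Real.sqrt_eq_rpow]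
  simp

/-- The `L^p` norm of a standard Gaussian random variable. -/
noncomputable def gaussianLpConst (p : ℝ≥0∞) : ℝ≥0∞ := eLpNorm id p (gaussianReal 0 1)

theorem gaussianLpConst_lt_top {p : ℝ≥0∞} (hp : p ≠ ∞) : gaussianLpConst p < ∞ :=
  (IsGaussian.hasGaussianLaw_id.memLp hp).2

section Wiener

variable {Ω : Type*} {m : MeasurableSpace Ω} {P : Measure Ω} {W : ℝ → Ω → ℝ}

/-- A centred Gaussian variable has the law of its standard deviation times a standard one, so its
`L^p` norm is a fixed multiple of its `L²` norm. -/
theorem eLpNorm_of_hasGaussianLaw {X : Ω → ℝ} (hX : HasGaussianLaw X P) (h0 : ∫ ω, X ω ∂P = 0)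
    (p : ℝ≥0∞) : eLpNorm X p P = gaussianLpConst p * eLpNorm X 2 P := by
  have hP := hX.isProbabilityMeasure
  have hv : Var[X; P] = ∫ ω, X ω ^ 2 ∂P := by
    rw [variance_eq_sub hX.memLp_two, h0]
    simp
  have hmap : P.map X = (gaussianReal 0 1).map (fun x => √(∫ ω, X ω ^ 2 ∂P) * x) := by
    rw [hX.map_eq_gaussianReal, h0, gaussianReal_map_const_mul, mul_zero, mul_one, hv]
    congr 1
    ext
    rw [Real.coe_toNNReal _ (integral_nonneg fun _ => sq_nonneg _)]
    exact (Real.sq_sqrt (integral_nonneg fun _ => sq_nonneg _)).symm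
  have h1 : eLpNorm X p P = eLpNorm id p (P.map X) :=
    (eLpNorm_map_measure aestronglyMeasurable_id hX.aemeasurable).symm
  have hm : Measurable fun x : ℝ => √(∫ ω, X ω ^ 2 ∂P) * x := by fun_prop
  rw [h1, hmap, eLpNorm_map_measure aestronglyMeasurable_id hm.aemeasurable,
    eLpNorm_two_eq_ofReal_sqrt hX.memLp_two, gaussianLpConst]
  have e : id ∘ (fun x : ℝ => √(∫ ω, X ω ^ 2 ∂P) * x) = √(∫ ω, X ω ^ 2 ∂P) • id := rfl
  rw [e, eLpNorm_const_smul, Real.enorm_of_nonneg (Real.sqrt_nonneg _), mul_comm]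

/-! ### Integrals of step functions -/

theorem memLp_stepFun (n : ℕ) (c a b : ℕ → ℝ) : MemLp (stepFun n c a b) 2 volume := by
  refine memLp_finsetSum (f := fun i s => c i * (Ioc (a i) (b i)).indicator (fun _ => (1 : ℝ)) s)
    _ fun i _ => ?_
  exact (memLp_indicator_const 2 measurableSet_Ioc 1 (Or.inr measure_Ioc_lt_top.ne)).const_mul _

theorem integral_mul_of_isFractionalBrownianMotion
    (hW : IsFractionalBrownianMotion (1 / 2) W P) (s t : ℝ) :
    ∫ ω, W s ω * W t ω ∂P = (|s| + |t| - |t - s|) / 2 := by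
  have hP := hW.gaussian.isProbabilityMeasure
  have h := covariance_eq_sub (hW.gaussian.hasGaussianLaw_eval s).memLp_two
    (hW.gaussian.hasGaussianLaw_eval t).memLp_two
  rw [hW.covariance_eq, hW.mean_zero, zero_mul, sub_zero] at h
  have e : (2 * (1 / 2) : ℝ) = 1 := by norm_num
  simp only [e, Real.rpow_one] at h
  exact h.symm

theorem integral_increment_mul_increment (hW : IsFractionalBrownianMotion (1 / 2) W P)
    {a b a' b' : ℝ} (h : a ≤ b) (h' : a' ≤ b') :
    ∫ ω, (W b ω - W a ω) * (W b' ω - W a' ω) ∂P =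
      ∫ s, (Ioc a b).indicator (fun _ => (1 : ℝ)) s * (Ioc a' b').indicator (fun _ => 1) s := by
  have hi : ∀ s t, Integrable (fun ω => W s ω * W t ω) P := fun s t =>
    (hW.gaussian.hasGaussianLaw_eval s).memLp_two.integrable_mul
      (hW.gaussian.hasGaussianLaw_eval t).memLp_two
  have e : ∀ ω, (W b ω - W a ω) * (W b' ω - W a' ω) =
      (W b ω * W b' ω - W b ω * W a' ω) - (W a ω * W b' ω - W a ω * W a' ω) := fun ω => by ring
  have hi2 : ∀ s t t', Integrable (fun ω => W s ω * W t ω - W s ω * W t' ω) P := fun s t t' =>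
    (hi s t).sub (hi s t')
  simp only [e]
  rw [integral_sub (hi2 _ _ _) (hi2 _ _ _),
    integral_sub (hi _ _) (hi _ _), integral_sub (hi _ _) (hi _ _)]
  simp only [integral_mul_of_isFractionalBrownianMotion hW]
  have e2 : ∀ s, (Ioc a b).indicator (fun _ => (1 : ℝ)) s * (Ioc a' b').indicator (fun _ => 1) s =
      (Ioc (max a a') (min b b')).indicator (fun _ => 1) s := by
    intro s
    rw [← Ioc_inter_Ioc]
    by_cases h1 : s ∈ Ioc a b <;> by_cases h2 : s ∈ Ioc a' b' <;> simp [h1, h2]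
  simp only [e2]
  rw [integral_indicator_const _ measurableSet_Ioc, Real.volume_real_Ioc, smul_eq_mul, mul_one]
  -- Both sides are piecewise linear in the four endpoints, so each ordering of them leaves linear
  -- arithmetic. The maximum with `0` in the length of the intersection accounts for disjoint
  -- intervals.
  rcases max_cases a a' with ⟨h1, _⟩ | ⟨h1, _⟩ <;> rcases min_cases b b' with ⟨h2, _⟩ | ⟨h2, _⟩ <;>
  rw [h1, h2] <;>
  rcases abs_cases (b' - b) with ⟨i1, _⟩ | ⟨i1, _⟩ <;>
  rcases abs_cases (a' - b) with ⟨i2, _⟩ | ⟨i2, _⟩ <;>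
  rcases abs_cases (b' - a) with ⟨i3, _⟩ | ⟨i3, _⟩ <;>
  rcases abs_cases (a' - a) with ⟨i4, _⟩ | ⟨i4, _⟩ <;>
  rw [i1, i2, i3, i4] <;> (rw [max_def]; split_ifs <;> linarith)

/-- The integral is a continuous linear functional of the Gaussian vector of values of `W` at the
endpoints. -/
theorem hasGaussianLaw_stepIntegral (hW : IsFractionalBrownianMotion (1 / 2) W P) (n : ℕ)
    (c a b : ℕ → ℝ) : HasGaussianLaw (stepIntegral W n c a b) P := by
  classical
  let I : Finset ℝ := (Finset.range n).image a ∪ (Finset.range n).image b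
  let ev : ℝ → (I → ℝ) →L[ℝ] ℝ := fun t =>
    if h : t ∈ I then ContinuousLinearMap.proj ⟨t, h⟩ else 0
  have hev : ∀ t ∈ I, ∀ ω, ev t (I.restrict (W · ω)) = W t ω := by
    intro t ht ω
    simp only [ev, dif_pos ht]
    rfl
  have key := (hW.gaussian.hasGaussianLaw I).map
    (∑ i ∈ Finset.range n, c i • (ev (b i) - ev (a i)))
  convert! key using 1
  funext ω
  simp only [stepIntegral, Function.comp_apply, sum_apply, smul_apply,
    sub_apply, smul_eq_mul]
  refine Finset.sum_congr rfl fun i hi => ?_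
  rw [hev _ (Finset.mem_union_right _ (Finset.mem_image_of_mem b hi)),
    hev _ (Finset.mem_union_left _ (Finset.mem_image_of_mem a hi))]

theorem integral_stepIntegral (hW : IsFractionalBrownianMotion (1 / 2) W P) (n : ℕ)
    (c a b : ℕ → ℝ) : ∫ ω, stepIntegral W n c a b ω ∂P = 0 := by
  have hi : ∀ t, Integrable (W t) P := fun t => (hW.gaussian.hasGaussianLaw_eval t).integrable
  have hi2 : ∀ i, Integrable (fun ω => c i * (W (b i) ω - W (a i) ω)) P := fun i =>
    ((hi _).sub (hi _)).const_mul _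
  unfold stepIntegral
  rw [integral_finsetSum _ fun i _ => hi2 i]
  refine Finset.sum_eq_zero fun i _ => ?_
  rw [integral_const_mul, integral_sub (hi _) (hi _), hW.mean_zero, hW.mean_zero, sub_zero,
    mul_zero]

/-- The Itô isometry for step functions. The intervals may overlap, so the double sum is compared
entry by entry and no orthogonality is invoked. -/
theorem integral_stepIntegral_sq (hW : IsFractionalBrownianMotion (1 / 2) W P) {n : ℕ}
    {c a b : ℕ → ℝ} (hab : ∀ i < n, a i ≤ b i) :
    ∫ ω, stepIntegral W n c a b ω ^ 2 ∂P = ∫ s, stepFun n c a b s ^ 2 := by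
  have hL : ∀ t, MemLp (W t) 2 P := fun t => (hW.gaussian.hasGaussianLaw_eval t).memLp_two
  have hI : ∀ a b : ℝ, MemLp ((Ioc a b).indicator fun _ => (1 : ℝ)) 2 volume := fun a b =>
    memLp_indicator_const 2 measurableSet_Ioc 1 (Or.inr measure_Ioc_lt_top.ne)
  have e : ∀ g : ℕ → ℝ, (∑ i ∈ Finset.range n, c i * g i) ^ 2 =
      ∑ i ∈ Finset.range n, ∑ j ∈ Finset.range n, c i * c j * (g i * g j) := by
    intro g
    rw [sq, Finset.sum_mul_sum]
    refine Finset.sum_congr rfl fun i _ => Finset.sum_congr rfl fun j _ => by ring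
  have h1 := fun ω => e (fun i => W (b i) ω - W (a i) ω)
  have h2 := fun s => e (fun i => (Ioc (a i) (b i)).indicator (fun _ => (1 : ℝ)) s)
  simp only [stepIntegral, stepFun, h1, h2]
  have i1 : ∀ i j, Integrable (fun ω => (W (b i) ω - W (a i) ω) * (W (b j) ω - W (a j) ω)) P :=
    fun i j => ((hL _).sub (hL _)).integrable_mul ((hL _).sub (hL _))
  have i2 : ∀ i j, Integrable (fun s => (Ioc (a i) (b i)).indicator (fun _ => (1 : ℝ)) s *
      (Ioc (a j) (b j)).indicator (fun _ => (1 : ℝ)) s) volume :=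
    fun i j => (hI _ _).integrable_mul (hI _ _)
  rw [integral_finsetSum _ fun i _ => integrable_finsetSum _ fun j _ => (i1 i j).const_mul _,
    integral_finsetSum _ fun i _ => integrable_finsetSum _ fun j _ => (i2 i j).const_mul _]
  refine Finset.sum_congr rfl fun i hi => ?_
  rw [integral_finsetSum _ fun j _ => (i1 i j).const_mul _,
    integral_finsetSum _ fun j _ => (i2 i j).const_mul _]
  refine Finset.sum_congr rfl fun j hj => ?_
  rw [integral_const_mul, integral_const_mul, integral_increment_mul_increment hW
    (hab i (Finset.mem_range.1 hi)) (hab j (Finset.mem_range.1 hj))]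

theorem eLpNorm_stepIntegral (hW : IsFractionalBrownianMotion (1 / 2) W P) {n : ℕ}
    {c a b : ℕ → ℝ} (hab : ∀ i < n, a i ≤ b i) :
    eLpNorm (stepIntegral W n c a b) 2 P = eLpNorm (stepFun n c a b) 2 volume := by
  rw [eLpNorm_two_eq_ofReal_sqrt (hasGaussianLaw_stepIntegral hW n c a b).memLp_two,
    eLpNorm_two_eq_ofReal_sqrt (memLp_stepFun n c a b), integral_stepIntegral_sq hW hab]

/-- Because overlapping intervals are allowed, a linear combination is just the concatenation of two
lists; no common refinement is needed. -/
theorem exists_step_add (n k : ℕ) (c a b c' a' b' : ℕ → ℝ) (r : ℝ) (hab : ∀ i < n, a i ≤ b i)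
    (hab' : ∀ i < k, a' i ≤ b' i) : ∃ c'' a'' b'' : ℕ → ℝ, (∀ i < n + k, a'' i ≤ b'' i) ∧
      (∀ s, stepFun (n + k) c'' a'' b'' s = stepFun n c a b s + r * stepFun k c' a' b' s) ∧
      ∀ ω, stepIntegral W (n + k) c'' a'' b'' ω =
        stepIntegral W n c a b ω + r * stepIntegral W k c' a' b' ω := by
  refine ⟨fun i => if i < n then c i else r * c' (i - n), fun i => if i < n then a i else a' (i - n),
    fun i => if i < n then b i else b' (i - n), fun i hi => ?_, fun s => ?_, fun ω => ?_⟩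
  · by_cases h : i < n
    · simpa [h] using hab i h
    · simpa [h] using hab' (i - n) (by omega)
  all_goals
    simp only [stepFun, stepIntegral]
    rw [Finset.sum_range_add, Finset.mul_sum]
    congr 1
    · refine Finset.sum_congr rfl fun i hi => ?_
      simp [Finset.mem_range.1 hi]
    · refine Finset.sum_congr rfl fun i _ => ?_
      simp [mul_assoc]

theorem eLpNorm_add_smul_le {S : Type*} {mS : MeasurableSpace S} {μ : Measure S} {u v : S → ℝ}
    {r : ℝ} {ε : ℝ≥0∞} (hu : AEStronglyMeasurable u μ) (hv : AEStronglyMeasurable v μ)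
    (hu' : eLpNorm u 2 μ ≤ ε / (1 + ‖r‖ₑ)) (hv' : eLpNorm v 2 μ ≤ ε / (1 + ‖r‖ₑ)) :
    eLpNorm (u + r • v) 2 μ ≤ ε := by
  refine (eLpNorm_add_le hu (hv.const_smul r) one_le_two).trans ?_
  rw [eLpNorm_const_smul]
  calc eLpNorm u 2 μ + ‖r‖ₑ * eLpNorm v 2 μ
      ≤ ε / (1 + ‖r‖ₑ) + ‖r‖ₑ * (ε / (1 + ‖r‖ₑ)) := by gcongr
    _ = (1 + ‖r‖ₑ) * (ε / (1 + ‖r‖ₑ)) := by rw [add_mul, one_mul]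
    _ ≤ ε := ENNReal.mul_div_le

/-! ### Wiener integrals -/

namespace IsWienerIntegral

variable {f g : ℝ → ℝ} {X Y : Ω → ℝ}

theorem add_const_mul (hW : IsFractionalBrownianMotion (1 / 2) W P)
    (hf : IsWienerIntegral W P f X) (hg : IsWienerIntegral W P g Y) (r : ℝ) :
    IsWienerIntegral W P (fun s => f s + r * g s) (fun ω => X ω + r * Y ω) := by
  refine ⟨hf.1.add (hg.1.const_mul r), hf.2.1.add (hg.2.1.const_mul r), fun ε hε => ?_⟩
  have hr : 1 + ‖r‖ₑ ≠ ∞ := by simp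
  obtain ⟨n, c, a, b, hab, h1, h2⟩ := hf.2.2 (ε / (1 + ‖r‖ₑ)) (ENNReal.div_pos hε.ne' hr)
  obtain ⟨k, c', a', b', hab', h1', h2'⟩ := hg.2.2 (ε / (1 + ‖r‖ₑ)) (ENNReal.div_pos hε.ne' hr)
  obtain ⟨c'', a'', b'', hab'', e1, e2⟩ := exists_step_add (W := W) n k c a b c' a' b' r hab hab'
  have hI := fun n c a b => (hasGaussianLaw_stepIntegral hW n c a b).memLp_two
  refine ⟨n + k, c'', a'', b'', hab'', ?_, ?_⟩
  · have e : (fun s => f s + r * g s - stepFun (n + k) c'' a'' b'' s) =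
        (fun s => f s - stepFun n c a b s) + r • fun s => g s - stepFun k c' a' b' s := by
      funext s
      simp only [e1, Pi.add_apply, Pi.smul_apply, smul_eq_mul]
      ring
    rw [e]
    exact eLpNorm_add_smul_le (hf.1.sub (memLp_stepFun _ _ _ _)).1 (hg.1.sub (memLp_stepFun _ _ _ _)).1 h1 h1'
  · have e : (fun ω => X ω + r * Y ω - stepIntegral W (n + k) c'' a'' b'' ω) =
        (fun ω => X ω - stepIntegral W n c a b ω) + r • fun ω => Y ω - stepIntegral W k c' a' b' ω := by
      funext s
      simp only [e2, Pi.add_apply, Pi.smul_apply, smul_eq_mul]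
      ring
    rw [e]
    exact eLpNorm_add_smul_le (hf.2.1.sub (hI _ _ _ _)).1 (hg.2.1.sub (hI _ _ _ _)).1 h2 h2'

/-- Wiener integrals are closed under joint `L²` limits of integrand and integral: a step
approximation of a late member of the sequence also approximates the limit. -/
theorem of_tendsto {f : ℕ → ℝ → ℝ} {X : ℕ → Ω → ℝ} {g : ℝ → ℝ} {Y : Ω → ℝ}
    (hW : IsFractionalBrownianMotion (1 / 2) W P)
    (hf : ∀ n, IsWienerIntegral W P (f n) (X n)) (hg : MemLp g 2 volume) (hY : MemLp Y 2 P)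
    (hfg : Tendsto (fun n => eLpNorm (fun s => f n s - g s) 2 volume) atTop (𝓝 0))
    (hXY : Tendsto (fun n => eLpNorm (fun ω => X n ω - Y ω) 2 P) atTop (𝓝 0)) :
    IsWienerIntegral W P g Y := by
  refine ⟨hg, hY, fun ε hε => ?_⟩
  have hε2 : 0 < ε / 2 := ENNReal.half_pos hε.ne'
  obtain ⟨k, hk1, hk2⟩ := ((hfg.eventually (ge_mem_nhds hε2)).and
    (hXY.eventually (ge_mem_nhds hε2))).exists
  obtain ⟨n, c, a, b, hab, h1, h2⟩ := (hf k).2.2 (ε / 2) hε2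
  refine ⟨n, c, a, b, hab, ?_, ?_⟩
  · have e : (fun s => g s - stepFun n c a b s) =
        (fun s => f k s - stepFun n c a b s) - fun s => f k s - g s := by
      funext s
      simp
    rw [e]
    refine (eLpNorm_sub_le ((hf k).1.sub (memLp_stepFun n c a b)).1 ((hf k).1.sub hg).1
      one_le_two).trans ((add_le_add h1 hk1).trans_eq (ENNReal.add_halves ε))
  · have e : (fun ω => Y ω - stepIntegral W n c a b ω) =
        (fun ω => X k ω - stepIntegral W n c a b ω) - fun ω => X k ω - Y ω := by
      funext s
      simp
    rw [e]
    refine (eLpNorm_sub_le ((hf k).2.1.sub (hasGaussianLaw_stepIntegral hW n c a b).memLp_two).1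
      ((hf k).2.1.sub hY).1 one_le_two).trans ((add_le_add h2 hk2).trans_eq (ENNReal.add_halves ε))

/-- A sequence of step functions whose integrals converge to the Wiener integral, in `L²` and
almost surely. -/
theorem exists_seq (hW : IsFractionalBrownianMotion (1 / 2) W P) (hf : IsWienerIntegral W P f X) :
    ∃ (n : ℕ → ℕ) (c a b : ℕ → ℕ → ℝ), (∀ k, ∀ i < n k, a k i ≤ b k i) ∧
      Tendsto (fun k => eLpNorm (fun s => f s - stepFun (n k) (c k) (a k) (b k) s) 2 volume) atTop
        (𝓝 0) ∧
      Tendsto (fun k => eLpNorm (fun ω => X ω - stepIntegral W (n k) (c k) (a k) (b k) ω) 2 P) atTop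
        (𝓝 0) ∧
      ∀ᵐ ω ∂P, Tendsto (fun k => stepIntegral W (n k) (c k) (a k) (b k) ω) atTop (𝓝 (X ω)) := by
  have hpos : ∀ k : ℕ, (0 : ℝ≥0∞) < (k + 1 : ℝ≥0∞)⁻¹ := fun k =>
    ENNReal.inv_pos.2 (by simp)
  choose n c a b hab h1 h2 using fun k => hf.2.2 _ (hpos k)
  have h0 : Tendsto (fun k : ℕ => (k + 1 : ℝ≥0∞)⁻¹) atTop (𝓝 0) := by
    have := (tendsto_add_atTop_iff_nat 1).2 ENNReal.tendsto_inv_nat_nhds_zero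
    exact this.congr fun k => by push_cast; rfl
  have t1 := tendsto_of_tendsto_of_tendsto_of_le_of_le tendsto_const_nhds h0 (fun _ => zero_le) h1
  have t2 := tendsto_of_tendsto_of_tendsto_of_le_of_le tendsto_const_nhds h0 (fun _ => zero_le) h2
  have hI := fun k => (hasGaussianLaw_stepIntegral hW (n k) (c k) (a k) (b k)).memLp_two.1
  have t3 : Tendsto (fun k => eLpNorm (stepIntegral W (n k) (c k) (a k) (b k) - X) 2 P) atTop
      (𝓝 0) := by
    refine t2.congr fun k => ?_
    rw [← eLpNorm_neg]
    congr 1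
    funext ω
    simp
  obtain ⟨φ, hφ, hlim⟩ := (tendstoInMeasure_of_tendsto_eLpNorm two_ne_zero hI hf.2.1.1
    t3).exists_seq_tendsto_ae
  exact ⟨n ∘ φ, c ∘ φ, a ∘ φ, b ∘ φ, fun k => hab (φ k), t1.comp hφ.tendsto_atTop,
    t2.comp hφ.tendsto_atTop, hlim⟩

/-- The isometry passes to the limit; only this inequality is needed. -/
theorem eLpNorm_two_le (hW : IsFractionalBrownianMotion (1 / 2) W P)
    (hf : IsWienerIntegral W P f X) : eLpNorm X 2 P ≤ eLpNorm f 2 volume := by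
  refine ENNReal.le_of_forall_pos_le_add fun ε hε _ => ?_
  have hε2 : (0 : ℝ≥0∞) < (ε : ℝ≥0∞) / 2 := ENNReal.half_pos (by exact_mod_cast hε.ne')
  obtain ⟨n, c, a, b, hab, h1, h2⟩ := hf.2.2 _ hε2
  have hI := (hasGaussianLaw_stepIntegral hW n c a b).memLp_two
  have hS := memLp_stepFun n c a b
  have e1 : X = (fun ω => X ω - stepIntegral W n c a b ω) + stepIntegral W n c a b := by
    funext ω
    simp
  have e2 : stepFun n c a b = f - fun s => f s - stepFun n c a b s := by
    funext s
    simp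
  calc eLpNorm X 2 P ≤ ε / 2 + eLpNorm (stepIntegral W n c a b) 2 P := by
        nth_rewrite 1 [e1]
        exact (eLpNorm_add_le (hf.2.1.sub hI).1 hI.1 one_le_two).trans (add_le_add h2 le_rfl)
    _ = ε / 2 + eLpNorm (stepFun n c a b) 2 volume := by rw [eLpNorm_stepIntegral hW hab]
    _ ≤ ε / 2 + (eLpNorm f 2 volume + ε / 2) := by
        nth_rewrite 1 [e2]
        exact add_le_add le_rfl ((eLpNorm_sub_le hf.1.1 (hf.1.sub hS).1 one_le_two).trans
          (add_le_add le_rfl h1))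
    _ = eLpNorm f 2 volume + (ε / 2 + ε / 2) := by ring
    _ = _ := by rw [ENNReal.add_halves]

/-- The law of `X` is never identified: the Gaussian moment formula holds for step integrals, and
Fatou along an almost surely convergent sequence transfers the bound. -/
theorem eLpNorm_le (hW : IsFractionalBrownianMotion (1 / 2) W P)
    (hf : IsWienerIntegral W P f X) {p : ℝ≥0∞} (hp : p ≠ ∞) :
    eLpNorm X p P ≤ gaussianLpConst p * eLpNorm f 2 volume := by
  obtain ⟨n, c, a, b, hab, t1, _, hae⟩ := hf.exists_seq hW
  have hI := fun k => hasGaussianLaw_stepIntegral hW (n k) (c k) (a k) (b k)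
  have hS := fun k => memLp_stepFun (n k) (c k) (a k) (b k)
  have hbound : ∀ k, eLpNorm (stepIntegral W (n k) (c k) (a k) (b k)) p P ≤ gaussianLpConst p *
      (eLpNorm f 2 volume + eLpNorm (fun s => f s - stepFun (n k) (c k) (a k) (b k) s) 2 volume) := by
    intro k
    rw [eLpNorm_of_hasGaussianLaw (hI k) (integral_stepIntegral hW _ _ _ _),
      eLpNorm_stepIntegral hW (hab k)]
    have e : stepFun (n k) (c k) (a k) (b k) =
        f - fun s => f s - stepFun (n k) (c k) (a k) (b k) s := by
      funext s
      simp
    nth_rewrite 1 [e]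
    gcongr
    exact eLpNorm_sub_le hf.1.1 (hf.1.sub (hS k)).1 one_le_two
  have hlim := ENNReal.Tendsto.const_mul (a := gaussianLpConst p)
    (t1.const_add (eLpNorm f 2 volume)) (Or.inr (gaussianLpConst_lt_top hp).ne)
  rw [add_zero] at hlim
  calc eLpNorm X p P
      ≤ atTop.liminf fun k => eLpNorm (stepIntegral W (n k) (c k) (a k) (b k)) p P :=
        Lp.eLpNorm_lim_le_liminf_eLpNorm (fun k => (hI k).aemeasurable.aestronglyMeasurable) X hae
    _ ≤ _ := liminf_le_liminf (Eventually.of_forall hbound)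
    _ = _ := hlim.liminf_eq

/-- A Wiener integral of a function which vanishes after `t` is almost surely equal to a random
variable which is measurable with respect to the past of `W` before `t`. -/
theorem exists_measurable_ae_eq (hW : IsFractionalBrownianMotion (1 / 2) W P)
    (hf : IsWienerIntegral W P f X) {t : ℝ} (hft : ∀ s, t < s → f s = 0)
    {m' : MeasurableSpace Ω} (hm' : ∀ s ≤ t, Measurable[m'] (W s)) :
    ∃ Z : Ω → ℝ, Measurable[m'] Z ∧ X =ᵐ[P] Z := by
  obtain ⟨n, c, a, b, hab, t1, t2, _⟩ := hf.exists_seq hW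
  -- Cutting all intervals at `t` multiplies each step function by the indicator of `(-∞, t]`. As
  -- `f` vanishes beyond `t`, the approximation does not get worse, and the integrals now involve
  -- only the past of `W`.
  let a' : ℕ → ℕ → ℝ := fun k i => min (a k i) t
  let b' : ℕ → ℕ → ℝ := fun k i => min (b k i) t
  have hab' : ∀ k, ∀ i < n k, a' k i ≤ b' k i := fun k i hi => min_le_min_right t (hab k i hi)
  have hS := fun k => memLp_stepFun (n k) (c k) (a k) (b k)
  have hS' := fun k => memLp_stepFun (n k) (c k) (a' k) (b' k)
  have hI := fun k => (hasGaussianLaw_stepIntegral hW (n k) (c k) (a k) (b k)).memLp_two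
  have hI' := fun k => (hasGaussianLaw_stepIntegral hW (n k) (c k) (a' k) (b' k)).memLp_two
  have hcut : ∀ k s, stepFun (n k) (c k) (a' k) (b' k) s =
      if s ≤ t then stepFun (n k) (c k) (a k) (b k) s else 0 := by
    intro k s
    have e : ∀ i, (Ioc (a' k i) (b' k i)).indicator (fun _ => (1 : ℝ)) s =
        if s ≤ t then (Ioc (a k i) (b k i)).indicator (fun _ => (1 : ℝ)) s else 0 := by
      intro i
      by_cases hs : s ≤ t
      · simp [indicator, a', b', hs, hs.not_gt]
      · simp [indicator, b', hs]
    simp only [stepFun, e]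
    split_ifs <;> simp
  have hle : ∀ k, eLpNorm (fun s => f s - stepFun (n k) (c k) (a' k) (b' k) s) 2 volume ≤
      eLpNorm (fun s => f s - stepFun (n k) (c k) (a k) (b k) s) 2 volume := by
    intro k
    refine eLpNorm_mono fun s => ?_
    rw [hcut]
    split_ifs with hs
    · exact le_rfl
    · rw [hft s (not_le.1 hs), sub_zero, norm_zero]
      exact norm_nonneg _
  -- The difference of the two step integrals is itself a step integral, so the isometry bounds it
  -- by the distance between the two approximations of `f`.
  have hdiff : ∀ k, eLpNorm (stepIntegral W (n k) (c k) (a k) (b k) -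
      stepIntegral W (n k) (c k) (a' k) (b' k)) 2 P ≤
      2 * eLpNorm (fun s => f s - stepFun (n k) (c k) (a k) (b k) s) 2 volume := by
    intro k
    obtain ⟨c2, a2, b2, hab2, e1, e2⟩ := exists_step_add (W := W) (n k) (n k) (c k) (a k) (b k)
      (c k) (a' k) (b' k) (-1) (hab k) (hab' k)
    have e3 : stepIntegral W (n k) (c k) (a k) (b k) - stepIntegral W (n k) (c k) (a' k) (b' k) =
        stepIntegral W (n k + n k) c2 a2 b2 := by
      funext ω
      rw [e2, Pi.sub_apply]
      ring
    have e4 : stepFun (n k + n k) c2 a2 b2 =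
        (fun s => f s - stepFun (n k) (c k) (a' k) (b' k) s) -
          fun s => f s - stepFun (n k) (c k) (a k) (b k) s := by
      funext s
      rw [e1, Pi.sub_apply]
      ring
    rw [e3, eLpNorm_stepIntegral hW hab2, e4, two_mul]
    exact (eLpNorm_sub_le (hf.1.sub (hS' k)).1 (hf.1.sub (hS k)).1 one_le_two).trans
      (add_le_add (hle k) le_rfl)
  have t3 : Tendsto (fun k => eLpNorm (stepIntegral W (n k) (c k) (a' k) (b' k) - X) 2 P) atTop
      (𝓝 0) := by
    have hsum := t2.add (ENNReal.Tendsto.const_mul (a := 2) t1 (Or.inr ENNReal.ofNat_ne_top))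
    rw [mul_zero, add_zero] at hsum
    refine tendsto_of_tendsto_of_tendsto_of_le_of_le tendsto_const_nhds hsum (fun _ => zero_le)
      fun k => ?_
    have e : stepIntegral W (n k) (c k) (a' k) (b' k) - X =
        -((fun ω => X ω - stepIntegral W (n k) (c k) (a k) (b k) ω) +
          (stepIntegral W (n k) (c k) (a k) (b k) - stepIntegral W (n k) (c k) (a' k) (b' k))) := by
      funext ω
      simp
    dsimp only
    rw [e, eLpNorm_neg]
    exact (eLpNorm_add_le (hf.2.1.sub (hI k)).1 ((hI k).sub (hI' k)).1 one_le_two).trans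
      (add_le_add le_rfl (hdiff k))
  obtain ⟨φ, hφ, hlim⟩ := (tendstoInMeasure_of_tendsto_eLpNorm two_ne_zero (fun k => (hI' k).1)
    hf.2.1.1 t3).exists_seq_tendsto_ae
  -- The limsup is measurable for `m'` at every `ω`, convergent or not, and equals `X` wherever the
  -- sequence converges to it.
  refine ⟨fun ω => limsup (fun k => stepIntegral W (n (φ k)) (c (φ k)) (a' (φ k)) (b' (φ k)) ω)
    atTop, ?_, ?_⟩
  · refine Measurable.limsup (mδ := m') fun k => ?_
    unfold stepIntegral
    refine Finset.measurable_fun_sum _ fun i _ => ?_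
    exact ((hm' _ (min_le_right _ _)).sub (hm' _ (min_le_right _ _))).const_mul _
  · filter_upwards [hlim] with ω hω
    exact hω.limsup_eq.symm

end IsWienerIntegral

end Wiener

/-! ### Riemann–Stieltjes integrals -/

theorem IsPartition.monotone {a b δ : ℝ} {n : ℕ} {x : ℕ → ℝ} (h : IsPartition a b δ n x) {i j : ℕ}
    (hij : i ≤ j) (hj : j ≤ n) : x i ≤ x j := by
  induction j, hij using Nat.le_induction with
  | base => exact le_rfl
  | succ j hij ih => exact (ih (by omega)).trans (h.le_succ j (by omega))

theorem IsPartition.mem_Icc {a b δ : ℝ} {n : ℕ} {x : ℕ → ℝ} (h : IsPartition a b δ n x) {i : ℕ}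
    (hi : i ≤ n) : x i ∈ Icc a b :=
  ⟨h.left ▸ h.monotone (Nat.zero_le i) hi, h.right ▸ h.monotone hi le_rfl⟩

theorem isPartition_uniform {t δ : ℝ} {n : ℕ} (ht : 0 ≤ t) (hn : 0 < n) (h : t / n < δ) :
    IsPartition 0 t δ n fun i => t / n * i where
  left := by simp
  right := by
    have : (n : ℝ) ≠ 0 := by positivity
    field_simp
  le_succ i _ := by
    gcongr
    simp
  mesh_lt i _ := by
    push_cast
    linarith [mul_add (t / n) i 1]

theorem exists_isPartition_uniform (t : ℝ) {δ : ℝ} (ht : 0 ≤ t) (hδ : 0 < δ) :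
    ∃ N : ℕ, ∀ n ≥ N, IsPartition 0 t δ n fun i => t / n * i := by
  obtain ⟨N, hN⟩ := exists_nat_gt (t / δ)
  refine ⟨N + 1, fun n hn => isPartition_uniform ht (by omega) ?_⟩
  have hn0 : (0 : ℝ) < n := by exact_mod_cast (by omega : 0 < n)
  rw [div_lt_iff₀ hn0]
  rw [div_lt_iff₀ hδ] at hN
  have : (N : ℝ) ≤ n := by exact_mod_cast (by omega : N ≤ n)
  nlinarith

/-- The assumption `0 ≤ t` is essential: for `t < 0` there is no partition and every number
qualifies as an integral. -/
theorem HasRSIntegral.unique {f g : ℝ → ℝ} {t I J : ℝ} (ht : 0 ≤ t) (hI : HasRSIntegral f g 0 t I)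
    (hJ : HasRSIntegral f g 0 t J) : I = J := by
  refine eq_of_forall_dist_le fun ε hε => ?_
  obtain ⟨δ, hδ, h1⟩ := hI (ε / 2) (half_pos hε)
  obtain ⟨δ', hδ', h2⟩ := hJ (ε / 2) (half_pos hε)
  obtain ⟨N, hN⟩ := exists_isPartition_uniform t ht (lt_min hδ hδ')
  have hp := hN N le_rfl
  have hp1 : IsPartition 0 t δ N _ := ⟨hp.left, hp.right, hp.le_succ, fun i hi =>
    (hp.mesh_lt i hi).trans_le (min_le_left _ _)⟩
  have hp2 : IsPartition 0 t δ' N _ := ⟨hp.left, hp.right, hp.le_succ, fun i hi =>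
    (hp.mesh_lt i hi).trans_le (min_le_right _ _)⟩
  have a1 := h1 N _ _ hp1 fun i hi => ⟨le_rfl, hp.le_succ i hi⟩
  have a2 := h2 N _ _ hp2 fun i hi => ⟨le_rfl, hp.le_succ i hi⟩
  rw [abs_sub_comm] at a1
  rw [Real.dist_eq]
  exact ((abs_sub_le _ _ _).trans (add_le_add a1.le a2.le)).trans_eq (add_halves ε)

theorem hasRSIntegral_rsIntegral {f g : ℝ → ℝ} {a b I : ℝ} (h : HasRSIntegral f g a b I) :
    HasRSIntegral f g a b (rsIntegral f g a b) := by
  have h' : ∃ I, HasRSIntegral f g a b I := ⟨I, h⟩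
  rw [rsIntegral, dif_pos h']
  exact h'.choose_spec

/-- The error of integration by parts on one cell. Splitting at the tag `ξ`, it equals the integral
of `(g - g x) f'` over `[x, ξ]` plus that of `(g - g y) f'` over `[ξ, y]`. As `f' ≥ 0`, the
oscillation bound integrates to `η` times the increment of `f`, which telescopes over the cells. -/
theorem abs_mul_sub_sub_integral_le {f f' g : ℝ → ℝ} (hf : ∀ u, HasDerivAt f (f' u) u)
    (hf' : Continuous f') (h0 : ∀ u, 0 ≤ f' u) (hg : Continuous g) {x y ξ η : ℝ}
    (hξ : ξ ∈ Icc x y) (hη : ∀ u ∈ Icc x y, ∀ v ∈ Icc x y, |g u - g v| ≤ η) :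
    |f ξ * (g y - g x) - ((f y * g y - f x * g x) - ∫ u in x..y, g u * f' u)| ≤
      η * (f y - f x) := by
  have hi : ∀ p q, IntervalIntegrable f' volume p q := fun p q => hf'.intervalIntegrable p q
  have hgi : ∀ p q, IntervalIntegrable (fun u => g u * f' u) volume p q := fun p q =>
    (hg.mul hf').intervalIntegrable p q
  have hF : ∀ p q, ∫ u in p..q, f' u = f q - f p := fun p q =>
    intervalIntegral.integral_eq_sub_of_hasDerivAt (fun u _ => hf u) (hi p q)
  have key : ∀ p q z, p ≤ q → z ∈ Icc x y → Icc p q ⊆ Icc x y →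
      |(∫ u in p..q, g u * f' u) - g z * (f q - f p)| ≤ η * (f q - f p) := by
    intro p q z hpq hz hsub
    rw [← hF p q, ← intervalIntegral.integral_const_mul, ← intervalIntegral.integral_const_mul,
      ← intervalIntegral.integral_sub (hgi p q) ((hi p q).const_mul _)]
    rw [← Real.norm_eq_abs]
    refine intervalIntegral.norm_integral_le_of_norm_le hpq
      (Eventually.of_forall fun u hu => ?_) ((hi p q).const_mul _)
    rw [← sub_mul, Real.norm_eq_abs, abs_mul, abs_of_nonneg (h0 u)]
    exact mul_le_mul_of_nonneg_right (hη u (hsub (Ioc_subset_Icc_self hu)) z hz) (h0 u)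
  have hxy : x ≤ y := hξ.1.trans hξ.2
  have k1 := key x ξ x hξ.1 ⟨le_rfl, hxy⟩ (Icc_subset_Icc_right hξ.2)
  have k2 := key ξ y y hξ.2 ⟨hxy, le_rfl⟩ (Icc_subset_Icc_left hξ.1)
  have hadd := intervalIntegral.integral_add_adjacent_intervals (hgi x ξ) (hgi ξ y)
  have e : f ξ * (g y - g x) - ((f y * g y - f x * g x) - ∫ u in x..y, g u * f' u) =
      ((∫ u in x..ξ, g u * f' u) - g x * (f ξ - f x)) +
        ((∫ u in ξ..y, g u * f' u) - g y * (f y - f ξ)) := by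
    rw [← hadd]
    ring
  rw [e]
  refine (abs_add_le _ _).trans ((add_le_add k1 k2).trans_eq ?_)
  ring

/-- Integration by parts: the Riemann–Stieltjes integral of an increasing `C¹` function against a
continuous function exists. -/
theorem hasRSIntegral_of_hasDerivAt {f f' g : ℝ → ℝ} (hf : ∀ u, HasDerivAt f (f' u) u)
    (hf' : Continuous f') (h0 : ∀ u, 0 ≤ f' u) (hg : Continuous g) (a b : ℝ) :
    HasRSIntegral f g a b (f b * g b - f a * g a - ∫ u in a..b, g u * f' u) := by
  intro ε hε
  -- The cell errors telescope to this number times `f b - f a`, which is strictly less than `ε`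
  -- thanks to the `+ 1`.
  have hη0 : 0 < ε / (|f b - f a| + 1) := by positivity
  obtain ⟨δ, hδ, hunif⟩ := Metric.uniformContinuousOn_iff.1
    (isCompact_Icc.uniformContinuousOn_of_continuous (hg.continuousOn (s := Icc a b))) _ hη0
  refine ⟨δ, hδ, fun n x ξ hp hξ => ?_⟩
  have hgi : ∀ p q, IntervalIntegrable (fun u => g u * f' u) volume p q := fun p q =>
    (hg.mul hf').intervalIntegrable p q
  have hS : ∑ i ∈ Finset.range n, ((f (x (i + 1)) * g (x (i + 1)) - f (x i) * g (x i)) -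
      ∫ u in x i..x (i + 1), g u * f' u) =
      f b * g b - f a * g a - ∫ u in a..b, g u * f' u := by
    rw [Finset.sum_sub_distrib, Finset.sum_range_sub (fun i => f (x i) * g (x i)),
      intervalIntegral.sum_integral_adjacent_intervals
        (fun k _ => hgi _ _), hp.left, hp.right]
  rw [← hS, ← Finset.sum_sub_distrib]
  have hstep : ∀ i ∈ Finset.range n, |f (ξ i) * (g (x (i + 1)) - g (x i)) -
      ((f (x (i + 1)) * g (x (i + 1)) - f (x i) * g (x i)) -
        ∫ u in x i..x (i + 1), g u * f' u)| ≤
      ε / (|f b - f a| + 1) * (f (x (i + 1)) - f (x i)) := by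
    intro i hi
    have hin := Finset.mem_range.1 hi
    refine abs_mul_sub_sub_integral_le hf hf' h0 hg (hξ i hin) fun u hu v hv => ?_
    have hsub : Icc (x i) (x (i + 1)) ⊆ Icc a b :=
      Icc_subset_Icc (hp.mem_Icc hin.le).1 (hp.mem_Icc hin).2
    refine (hunif u (hsub hu) v (hsub hv) ?_).le
    exact (Real.dist_le_of_mem_Icc hu hv).trans_lt (hp.mesh_lt i hin)
  refine (Finset.abs_sum_le_sum_abs _ _).trans_lt ((Finset.sum_le_sum hstep).trans_lt ?_)
  rw [← Finset.mul_sum, Finset.sum_range_sub (fun i => f (x i)), hp.left, hp.right,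
    div_mul_eq_mul_div, div_lt_iff₀ (by positivity)]
  gcongr
  linarith [le_abs_self (f b - f a)]

theorem hasRSIntegral_exp {α : ℝ} (hα : 0 ≤ α) {g : ℝ → ℝ} (hg : Continuous g) (t : ℝ) :
    HasRSIntegral (fun u => Real.exp (α * u)) g 0 t
      (Real.exp (α * t) * g t - g 0 - α * ∫ u in (0 : ℝ)..t, g u * Real.exp (α * u)) := by
  have hder : ∀ u, HasDerivAt (fun u => Real.exp (α * u)) (α * Real.exp (α * u)) u := by
    intro u
    have := ((hasDerivAt_id u).const_mul α).exp
    exact this.congr_deriv (by simp only [id]; ring)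
  have h := hasRSIntegral_of_hasDerivAt hder (by fun_prop) (fun u => by positivity) hg 0 t
  convert! h using 1
  rw [← intervalIntegral.integral_const_mul, mul_zero, Real.exp_zero, one_mul]
  congr 2
  funext u
  ring

/-- The term `Z 0` is kept because the identity is pathwise, whereas `B^H_0 = 0` holds only almost
surely. -/
theorem ornsteinUhlenbeck_eq {Ω : Type*} {α : ℝ} (hα : 0 ≤ α) (lam0 : Ω → ℝ) {Z : ℝ → Ω → ℝ}
    {ω : Ω} (hZ : Continuous fun t => Z t ω) {t : ℝ} (ht : 0 ≤ t) :
    ornsteinUhlenbeck α lam0 Z t ω =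
      Real.exp (-α * t) * (lam0 ω - Z 0 ω) + derivProcess α Z t ω := by
  have h := hasRSIntegral_exp hα hZ t
  have e := (hasRSIntegral_rsIntegral h).unique ht h
  have e1 : Real.exp (-α * t) * Real.exp (α * t) = 1 := by
    rw [← Real.exp_add]
    simp
  rw [ornsteinUhlenbeck, e, derivProcess]
  linear_combination Z t ω * e1

/-! ### The quadratic variation of a correlated Brownian motion -/

section QuadVar

variable {Ω : Type*} {m : MeasurableSpace Ω} {P : Measure Ω}

/-- Independent Gaussian families are jointly Gaussian, and the covariance is `(ρ² + (1 - ρ²)) min s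
t` since the cross terms vanish. -/
theorem isPreBrownianReal_correlated {W : ℝ → Ω → ℝ}
    (hW : IsFractionalBrownianMotion (1 / 2) W P) {B : ℝ≥0 → Ω → ℝ} (hB : IsPreBrownianReal B P)
    (hWB : IndepFun (fun ω t => W t ω) (fun ω t => B t ω) P) {ρ : ℝ} (hρ : ρ ^ 2 ≤ 1) :
    IsPreBrownianReal (fun (t : ℝ≥0) ω => ρ * W t ω + √(1 - ρ ^ 2) * B t ω) P := by
  have hP := hW.gaussian.isProbabilityMeasure
  have hLW : ∀ t, MemLp (W t) 2 P := fun t => (hW.gaussian.hasGaussianLaw_eval t).memLp_two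
  have hLB : ∀ t, MemLp (B t) 2 P := fun t => (hB.isGaussianProcess.hasGaussianLaw_eval t).memLp_two
  have hcross : ∀ s t, cov[W s, B t; P] = 0 := fun s t =>
    (hWB.comp (measurable_pi_apply s) (measurable_pi_apply t)).covariance_eq_zero (hLW s) (hLB t)
  refine IsGaussianProcess.isPreBrownianReal_of_covariance ⟨fun I => ?_⟩ (fun t => ?_)
    fun s t hst => ?_
  · have hWI := (hW.gaussian.comp_right (fun t : ℝ≥0 => (t : ℝ))).hasGaussianLaw I
    have hBI := hB.isGaussianProcess.hasGaussianLaw I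
    have hind : IndepFun (fun ω => I.restrict (((W ∘ fun t : ℝ≥0 => (t : ℝ))) · ω))
        (fun ω => I.restrict (B · ω)) P :=
      hWB.comp (φ := fun (w : ℝ → ℝ) (i : I) => w (i : ℝ≥0)) (ψ := fun (w : ℝ≥0 → ℝ) (i : I) => w i)
        (measurable_pi_lambda _ fun i => measurable_pi_apply _)
        (measurable_pi_lambda _ fun i => measurable_pi_apply _)
    exact (hind.hasGaussianLaw hWI hBI).map
      (ρ • ContinuousLinearMap.fst ℝ (I → ℝ) (I → ℝ) +
        √(1 - ρ ^ 2) • ContinuousLinearMap.snd ℝ (I → ℝ) (I → ℝ))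
  · rw [integral_add (((hLW t).integrable one_le_two).const_mul _)
      (((hLB t).integrable one_le_two).const_mul _), integral_const_mul, integral_const_mul,
      hW.mean_zero, hB.integral_eval, mul_zero, mul_zero, add_zero]
  · have e : ∀ t : ℝ≥0, (fun ω => ρ * W t ω + √(1 - ρ ^ 2) * B t ω) =
        ρ • W t + √(1 - ρ ^ 2) • B t := fun t => rfl
    have hst' : (s : ℝ) ≤ t := hst
    have hcross' : ∀ s t, cov[B s, W t; P] = 0 := fun s t => by rw [covariance_comm, hcross]
    simp only [e]
    rw [covariance_add_left ((hLW s).const_smul ρ) ((hLB s).const_smul _)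
        (((hLW t).const_smul ρ).add ((hLB t).const_smul _)),
      covariance_add_right ((hLW s).const_smul ρ) ((hLW t).const_smul ρ) ((hLB t).const_smul _),
      covariance_add_right ((hLB s).const_smul _) ((hLW t).const_smul ρ) ((hLB t).const_smul _)]
    simp only [covariance_smul_left, covariance_smul_right, hcross, hcross', hW.covariance_eq,
      hB.covariance_eval]
    have e2 : (2 * (1 / 2) : ℝ) = 1 := by norm_num
    have e3 := Real.mul_self_sqrt (sub_nonneg.2 hρ)
    rw [e2, Real.rpow_one, Real.rpow_one, Real.rpow_one, abs_of_nonneg s.coe_nonneg,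
      abs_of_nonneg t.coe_nonneg,
      abs_of_nonneg (sub_nonneg.2 hst'), min_eq_left hst]
    linear_combination (s : ℝ) * e3

theorem variance_sq_of_hasLaw_gaussianReal {X : Ω → ℝ} {v : ℝ≥0}
    (hX : HasLaw X (gaussianReal 0 v) P) :
    Var[fun ω => X ω ^ 2; P] = v ^ 2 * Var[fun x => x ^ 2; gaussianReal 0 1] := by
  have hm : Measurable fun x : ℝ => √v * x := by fun_prop
  have hsq : Measurable fun x : ℝ => x ^ 2 := by fun_prop
  have hmap : gaussianReal 0 v = (gaussianReal 0 1).map (fun x => √v * x) := by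
    rw [gaussianReal_map_const_mul, mul_zero, mul_one]
    congr 1
    ext
    exact (Real.sq_sqrt v.2).symm
  have h1 : Var[fun ω => X ω ^ 2; P] = Var[fun x => x ^ 2; gaussianReal 0 v] := by
    rw [← hX.map_eq, variance_map hsq.aemeasurable hX.aemeasurable]
    rfl
  rw [h1, hmap, variance_map hsq.aemeasurable hm.aemeasurable, ← variance_const_mul]
  congr 1
  funext x
  simp [mul_pow]

theorem integral_sq_of_hasLaw_gaussianReal {X : Ω → ℝ} {v : ℝ≥0}
    (hX : HasLaw X (gaussianReal 0 v) P) : ∫ ω, X ω ^ 2 ∂P = v := by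
  have hP := hX.isProbabilityMeasure
  have h1 := variance_eq_sub hX.hasGaussianLaw.memLp_two
  have h2 : ∫ ω, X ω ∂P = 0 := by rw [hX.integral_eq, integral_id_gaussianReal]
  rw [hX.variance_eq, variance_id_gaussianReal, h2] at h1
  simpa using h1.symm

/-- The sums of squared increments of a Brownian motion along the uniform partitions of `[0, t]`
converge to `t` in probability. -/
theorem tendstoInMeasure_sum_sq {X : ℝ≥0 → Ω → ℝ} (hX : IsPreBrownianReal X P) (t : ℝ≥0) :
    TendstoInMeasure P (fun (n : ℕ) ω =>
      ∑ i ∈ Finset.range n, (X (t / n * (i + 1 : ℕ)) ω - X (t / n * i) ω) ^ 2) atTop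
      fun _ => (t : ℝ) := by
  have hP := hX.isGaussianProcess.isProbabilityMeasure
  have hlaw : ∀ (n : ℕ) (i : ℕ), HasLaw (X (t / n * (i + 1 : ℕ)) - X (t / n * i))
      (gaussianReal 0 (t / n)) P := by
    intro n i
    have h := hX.hasLaw_sub (t / n * (i + 1 : ℕ)) (t / n * i)
    convert h using 2
    ext
    rw [coe_nndist, Real.dist_eq]
    change ((t / n : ℝ≥0) : ℝ) = |((t / n * (i + 1 : ℕ) : ℝ≥0) : ℝ) - ((t / n * i : ℝ≥0) : ℝ)|
    have : ((t / n * (i + 1 : ℕ) : ℝ≥0) : ℝ) - ((t / n * i : ℝ≥0) : ℝ) = ((t / n : ℝ≥0) : ℝ) := by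
      push_cast
      ring
    rw [this, abs_of_nonneg (NNReal.coe_nonneg _)]
  have hL4 : ∀ n i : ℕ, MemLp (fun ω => (X (t / n * (i + 1 : ℕ)) ω - X (t / n * i) ω) ^ 2) 2 P := by
    intro n i
    have h4 : MemLp (X (t / n * (i + 1 : ℕ)) - X (t / n * i)) 4 P :=
      (hlaw n i).hasGaussianLaw.memLp ENNReal.ofNat_ne_top
    have : ENNReal.HolderTriple 4 4 2 := ⟨by
      rw [show (4 : ℝ≥0∞) = 2 * 2 by norm_num,
        ENNReal.mul_inv (Or.inl two_ne_zero) (Or.inl ENNReal.ofNat_ne_top), ← add_mul,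
        ENNReal.inv_two_add_inv_two, one_mul]⟩
    refine (h4.mul' (r := 2) h4).ae_eq (Eventually.of_forall fun ω => ?_)
    simp only [Pi.sub_apply, sq]
  -- By independence the variance is `n (t/n)² κ = t² κ / n`, where `κ` is the variance of the
  -- square of a standard normal; Chebyshev's inequality then gives convergence, and the value of
  -- `κ` is irrelevant.
  have hvar : ∀ n : ℕ, Var[fun ω => ∑ i ∈ Finset.range n,
      (X (t / n * (i + 1 : ℕ)) ω - X (t / n * i) ω) ^ 2; P] =
      n * ((t / n : ℝ≥0) ^ 2 * Var[fun x => x ^ 2; gaussianReal 0 1]) := by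
    intro n
    have hmono : Monotone fun i : ℕ => t / n * (i : ℝ≥0) := fun i j hij => by
      dsimp only
      gcongr
    have hind := (hX.hasIndepIncrements.nat hmono).comp (fun _ x => x ^ 2)
      fun _ => measurable_id.pow_const 2
    have h := IndepFun.variance_sum (μ := P) (s := Finset.range n)
      (X := fun i ω => (X (t / n * (i + 1 : ℕ)) ω - X (t / n * i) ω) ^ 2)
      (fun i _ => hL4 n i) fun i _ j _ hij => hind.indepFun hij
    have e : (∑ i ∈ Finset.range n, fun ω => (X (t / n * (i + 1 : ℕ)) ω - X (t / n * i) ω) ^ 2) =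
        fun ω => ∑ i ∈ Finset.range n, (X (t / n * (i + 1 : ℕ)) ω - X (t / n * i) ω) ^ 2 := by
      funext ω
      simp
    rw [e] at h
    have hv : ∀ i : ℕ, Var[fun ω => (X (t / n * (i + 1 : ℕ)) ω - X (t / n * i) ω) ^ 2; P] = _ :=
      fun i => variance_sq_of_hasLaw_gaussianReal (hlaw n i)
    rw [h, Finset.sum_congr rfl fun i _ => hv i,
      Finset.sum_const, Finset.card_range, nsmul_eq_mul]
  have hmean : ∀ n : ℕ, n ≠ 0 → ∫ ω, ∑ i ∈ Finset.range n,
      (X (t / n * (i + 1 : ℕ)) ω - X (t / n * i) ω) ^ 2 ∂P = t := by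
    intro n hn
    have hv : ∀ i : ℕ, ∫ ω, (X (t / n * (i + 1 : ℕ)) ω - X (t / n * i) ω) ^ 2 ∂P = _ :=
      fun i => integral_sq_of_hasLaw_gaussianReal (hlaw n i)
    rw [integral_finsetSum _ fun i _ => (hL4 n i).integrable one_le_two,
      Finset.sum_congr rfl fun i _ => hv i,
      Finset.sum_const, Finset.card_range, nsmul_eq_mul]
    have : (n : ℝ) ≠ 0 := by exact_mod_cast hn
    push_cast
    field_simp
  rw [tendstoInMeasure_iff_norm]
  intro ε hε
  set κ := Var[fun x => x ^ 2; gaussianReal 0 1]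
  have hlim : Tendsto (fun n : ℕ => ENNReal.ofReal ((t ^ 2 * κ / ε ^ 2) / n)) atTop (𝓝 0) := by
    rw [← ENNReal.ofReal_zero]
    exact ENNReal.tendsto_ofReal (tendsto_const_div_atTop_nhds_zero_nat _)
  refine tendsto_of_tendsto_of_tendsto_of_le_of_le' tendsto_const_nhds hlim
    (Eventually.of_forall fun _ => zero_le) ?_
  filter_upwards [eventually_ne_atTop 0] with n hn
  have h := meas_ge_le_variance_div_sq (memLp_finsetSum (Finset.range n) fun i _ => hL4 n i) hε
  rw [hmean n hn, hvar n] at h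
  refine h.trans_eq ?_
  congr 1
  have : (n : ℝ) ≠ 0 := by exact_mod_cast hn
  push_cast
  field_simp

variable {F : Filtration ℝ m} {T : ℝ} {M : ℝ → Ω → ℝ}

/-- Along uniform partitions the sums of squares converge in probability both to `⟨M⟩_t` and to `t`,
and limits in probability are almost surely unique. -/
theorem QuadraticVariation.ae_path_eq (Q : QuadraticVariation P F T M) {X : ℝ≥0 → Ω → ℝ}
    (hX : IsPreBrownianReal X P) (hM : ∀ t : ℝ≥0, M t = X t) {t : ℝ} (ht : t ∈ Icc 0 T) :
    ∀ᵐ ω ∂P, Q.path ω t = t := by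
  lift t to ℝ≥0 using ht.1
  have h1 := tendstoInMeasure_sum_sq hX t
  have h2 : TendstoInMeasure P (fun (n : ℕ) ω =>
      ∑ i ∈ Finset.range n, (X (t / n * (i + 1 : ℕ)) ω - X (t / n * i) ω) ^ 2) atTop
      fun ω => Q.path ω t := by
    rw [tendstoInMeasure_iff_norm]
    intro ε hε
    rw [ENNReal.tendsto_atTop_zero]
    intro η hη
    -- In `tendsto_sq` one number is both the threshold and the bound on the probability, so it has
    -- to lie below `ε` and `η` at once.
    obtain ⟨θ, hθ0, hθε, hθη⟩ : ∃ θ : ℝ, 0 < θ ∧ θ ≤ ε ∧ ENNReal.ofReal θ ≤ η := by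
      rcases eq_or_ne η ∞ with rfl | hη'
      · exact ⟨ε, hε, le_rfl, le_top⟩
      · refine ⟨min ε η.toReal, lt_min hε (ENNReal.toReal_pos hη.ne' hη'), min_le_left _ _, ?_⟩
        exact (ENNReal.ofReal_le_ofReal (min_le_right _ _)).trans ENNReal.ofReal_toReal_le
    obtain ⟨δ, hδ, hp⟩ := Q.tendsto_sq t ht θ hθ0
    obtain ⟨N, hN⟩ := exists_isPartition_uniform (t : ℝ) t.2 hδ
    refine ⟨N, fun n hn => ?_⟩
    refine (measure_mono fun ω hω => ?_).trans ((hp n _ (hN n hn)).trans hθη)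
    have e : ∀ i : ℕ, M (t / n * i) = X (t / n * i) := fun i => by
      rw [← hM]
      push_cast
      rfl
    simp only [mem_ofPred_eq, e] at hω ⊢
    exact hθε.trans hω
  filter_upwards [tendstoInMeasure_ae_unique h2 h1] with ω hω using hω

/-- The clock `d⟨M⟩` of a Brownian motion `M` is the Lebesgue measure on `(0, T]`. -/
theorem QuadraticVariation.ae_clock_eq (Q : QuadraticVariation P F T M) {X : ℝ≥0 → Ω → ℝ}
    (hX : IsPreBrownianReal X P) (hM : ∀ t : ℝ≥0, M t = X t) (hT : 0 ≤ T) :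
    ∀ᵐ ω ∂P, clock Q ω = volume.restrict (Ioc 0 T) := by
  have h0 := Q.ae_path_eq hX hM ⟨le_rfl, hT⟩
  have hTT := Q.ae_path_eq hX hM ⟨hT, le_rfl⟩
  -- The exceptional null set depends on the time. A common one exists for the rational times, and
  -- monotonicity of the path squeezes every interior time between rationals; the endpoints are
  -- treated apart.
  have hq : ∀ᵐ ω ∂P, ∀ q : ℚ, (q : ℝ) ∈ Icc 0 T → Q.path ω q = q := by
    rw [ae_all_iff]
    intro q
    by_cases h : (q : ℝ) ∈ Icc 0 T
    · filter_upwards [Q.ae_path_eq hX hM h] with ω hω _ using hω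
    · exact Eventually.of_forall fun ω h' => absurd h' h
  filter_upwards [h0, hTT, hq] with ω h0 hTT hq
  have hpath : ∀ s ∈ Icc 0 T, Q.path ω s = s := by
    intro s hs
    rcases hs.1.eq_or_lt with rfl | hs0
    · exact h0
    rcases hs.2.eq_or_lt with rfl | hsT
    · exact hTT
    refine le_antisymm (le_of_forall_gt fun r hr => ?_) (le_of_forall_lt fun r hr => ?_)
    · obtain ⟨q, hq1, hq2⟩ := exists_rat_btwn (lt_min hr hsT)
      refine ((Q.path ω).mono hq1.le).trans_lt ?_
      rw [hq q ⟨hs0.le.trans hq1.le, hq2.le.trans (min_le_right _ _)⟩]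
      exact hq2.trans_le (min_le_left _ _)
    · obtain ⟨q, hq1, hq2⟩ := exists_rat_btwn (max_lt hr hs0)
      refine lt_of_lt_of_le ?_ ((Q.path ω).mono hq2.le)
      rw [hq q ⟨(le_max_right _ _).trans hq1.le, hq2.le.trans hs.2⟩]
      exact (le_max_left _ _).trans_lt hq1
  refine Measure.ext_of_Iic _ _ fun t => ?_
  rw [clock_Iic, Measure.restrict_apply measurableSet_Iic, inter_comm, Ioc_inter_Iic,
    Real.volume_Ioc, h0, sub_zero, sub_zero]
  rcases lt_or_ge (min T t) 0 with h | h
  · rw [ENNReal.ofReal_of_nonpos h.le, ENNReal.ofReal_of_nonpos]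
    exact ((Q.path ω).mono h.le).trans_eq h0
  · rw [hpath _ ⟨h, min_le_left _ _⟩]

end QuadVar

/-! ### Progressive measurability -/

section Progressive

variable {Ω : Type*} {m : MeasurableSpace Ω} {P : Measure Ω}

/-- Completeness of `P` makes every null set measurable, hence a generator of each σ-algebra of the
filtration; modifying a variable on a null set is therefore harmless. -/
theorem measurable_completedFiltration_of_ae_eq [P.IsComplete] {W : ℝ → Ω → ℝ} {B : ℝ≥0 → Ω → ℝ}
    (hW : ∀ t, Measurable (W t)) (hB : ∀ t, Measurable (B t)) {t : ℝ} {X Z : Ω → ℝ}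
    (hZ : Measurable[completedFiltration P W B hW hB t] Z) (h : X =ᵐ[P] Z) :
    Measurable[completedFiltration P W B hW hB t] X := by
  have hnull : ∀ N, P N = 0 → MeasurableSet[completedFiltration P W B hW hB t] N := by
    intro N hN
    have h1 : MeasurableSet[MeasurableSpace.generateFrom {N | MeasurableSet N ∧ P N = 0}] N :=
      MeasurableSpace.measurableSet_generateFrom ⟨Measure.IsComplete.out' N hN, hN⟩
    exact (le_sup_right : _ ≤ completedFiltration P W B hW hB t) N h1
  intro s hs
  have e : X ⁻¹' s = (Z ⁻¹' s \ {ω | X ω ≠ Z ω}) ∪ (X ⁻¹' s ∩ {ω | X ω ≠ Z ω}) := by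
    ext ω
    by_cases hω : X ω = Z ω <;> simp [hω]
  have h0 : P {ω | X ω ≠ Z ω} = 0 := h
  rw [e]
  exact ((hZ hs).diff (hnull _ h0)).union (hnull _ (measure_mono_null inter_subset_right h0))

theorem measurable_completedFiltration {W : ℝ → Ω → ℝ} {B : ℝ≥0 → Ω → ℝ}
    (hW : ∀ t, Measurable (W t)) (hB : ∀ t, Measurable (B t)) {s t : ℝ} (hst : s ≤ t) :
    Measurable[completedFiltration P W B hW hB t] (W s) := by
  refine Measurable.mono (comap_measurable (W s)) ?_ le_rfl
  exact (le_iSup₂_of_le (f := fun s (_ : s ≤ t) => MeasurableSpace.comap (W s) inferInstance)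
    s hst le_rfl).trans (le_sup_left.trans le_sup_left)

theorem IsWienerIntegral.measurable_completedFiltration [P.IsComplete] {W : ℝ → Ω → ℝ}
    {B : ℝ≥0 → Ω → ℝ} (hWm : ∀ t, Measurable (W t)) (hBm : ∀ t, Measurable (B t))
    (hW : IsFractionalBrownianMotion (1 / 2) W P) {f : ℝ → ℝ} {X : Ω → ℝ}
    (hf : IsWienerIntegral W P f X) {t : ℝ} (hft : ∀ s, t < s → f s = 0) :
    Measurable[completedFiltration P W B hWm hBm t] X := by
  obtain ⟨Z, hZ, hXZ⟩ := hf.exists_measurable_ae_eq hW hft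
    (m' := completedFiltration P W B hWm hBm t)
    fun s hs => FracOU.measurable_completedFiltration hWm hBm hs
  exact measurable_completedFiltration_of_ae_eq hWm hBm hZ hXZ

variable {F : Filtration ℝ m} {T : ℝ}

theorem isProgressiveOn_of_continuous {X : ℝ → Ω → ℝ} (hc : ∀ ω, Continuous fun t => X t ω)
    (hX : ∀ t ∈ Icc 0 T, Measurable[F t] (X t)) : IsProgressiveOn F T X := by
  intro t ht
  refine measurable_uncurry_of_continuous_of_measurable (m := F t)
    (u := fun (s : Icc (0 : ℝ) t) ω => X s ω)
    (fun ω => (hc ω).comp continuous_subtype_val) fun s => ?_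
  exact (hX s ⟨s.2.1, s.2.2.trans ht.2⟩).mono (F.mono s.2.2) le_rfl

theorem IsProgressiveOn.congr {X Y : ℝ → Ω → ℝ} (hX : IsProgressiveOn F T X)
    (h : ∀ t ∈ Icc 0 T, ∀ ω, X t ω = Y t ω) : IsProgressiveOn F T Y := by
  intro t ht
  have e : (fun p : Icc (0 : ℝ) t × Ω => Y p.1 p.2) = fun p => X p.1 p.2 :=
    funext fun p => (h p.1 ⟨p.1.2.1, p.1.2.2.trans ht.2⟩ p.2).symm
  rw [e]
  exact hX t ht

theorem isProgressiveOn_limsup {X : ℕ → ℝ → Ω → ℝ} (hX : ∀ n, IsProgressiveOn F T (X n)) :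
    IsProgressiveOn F T fun t ω => limsup (fun n => X n t ω) atTop := by
  intro t ht
  exact Measurable.limsup fun n => hX n t ht

/-- Projecting `u` onto `[0, t]` and cutting off with the indicator of `0 < u ≤ s` gives a jointly
measurable integrand on a full product, to which Fubini's measurability statement applies. The
σ-algebra on `Ω` is left free so that it can be `F t`. -/
theorem measurable_intervalIntegral_of_measurable {Ω : Type*} [MeasurableSpace Ω] {t : ℝ}
    (ht : 0 ≤ t) {Y : ℝ → Ω → ℝ} (hY : Measurable fun p : Icc (0 : ℝ) t × Ω => Y p.1 p.2)
    {g : ℝ → ℝ} (hg : Measurable g) :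
    Measurable fun p : Icc (0 : ℝ) t × Ω => ∫ u in (0 : ℝ)..p.1, Y u p.2 * g u := by
  have hm : Measurable fun q : (Icc (0 : ℝ) t × Ω) × ℝ =>
      if 0 < q.2 ∧ q.2 ≤ q.1.1 then Y (projIcc 0 t ht q.2) q.1.2 * g q.2 else 0 := by
    refine Measurable.ite ?_ (Measurable.mul ?_ (hg.comp measurable_snd)) measurable_const
    · exact (measurableSet_lt measurable_const measurable_snd).inter
        (measurableSet_le measurable_snd (by fun_prop))
    · exact hY.comp (((continuous_projIcc (h := ht)).measurable.comp measurable_snd).prodMk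
        (measurable_snd.comp measurable_fst))
  have h := (hm.stronglyMeasurable.integral_prod_right' (ν := (volume : Measure ℝ))).measurable
  refine (congrArg Measurable (funext fun p => ?_)).mpr h
  rw [intervalIntegral.integral_of_le p.1.2.1, ← integral_indicator measurableSet_Ioc]
  refine integral_congr_ae (Eventually.of_forall fun u => ?_)
  by_cases hu : u ∈ Ioc (0 : ℝ) p.1
  · have hu' : 0 < u ∧ u ≤ p.1 := hu
    simp only [indicator_of_mem hu, if_pos hu']
    rw [projIcc_of_mem ht ⟨hu.1.le, hu.2.trans p.1.2.2⟩]
  · have hu' : ¬(0 < u ∧ u ≤ p.1) := hu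
    simp only [indicator_of_notMem hu, if_neg hu']

theorem IsProgressiveOn.derivProcess {Y : ℝ → Ω → ℝ} (hY : IsProgressiveOn F T Y) (α : ℝ) :
    IsProgressiveOn F T (derivProcess α Y) := by
  intro t ht
  have h1 := hY t ht
  have h2 := @measurable_intervalIntegral_of_measurable Ω (F t) t ht.1 Y h1
    (fun u => Real.exp (α * u)) (by fun_prop)
  have h3 : Measurable fun s : Icc (0 : ℝ) t => α * Real.exp (-α * s) := by fun_prop
  exact h1.sub ((h3.comp (@measurable_fst _ _ _ (F t))).mul h2)

end Progressive

/-! ### Estimates for the norm of `𝓓_β` -/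

section Norm

variable {Ω : Type*} {m : MeasurableSpace Ω} {P : Measure Ω} {F : Filtration ℝ m} {T : ℝ}
  {M : ℝ → Ω → ℝ} {Q : QuadraticVariation P F T M} {β : ℝ} {X Y : ℝ → Ω → ℝ}

theorem energy_congr {ω : Ω} (h : ∀ t ∈ Icc 0 T, X t ω = Y t ω) : energy Q X ω = energy Q Y ω :=
  setLIntegral_congr_fun measurableSet_Ioc fun t ht => by
    simp only [h t (Ioc_subset_Icc_self ht)]

theorem betaNorm_congr (h : ∀ᵐ ω ∂P, ∀ t ∈ Icc 0 T, X t ω = Y t ω) :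
    betaNorm Q β X = betaNorm Q β Y := by
  rw [betaNorm, betaNorm]
  congr 1
  refine lintegral_congr_ae ?_
  filter_upwards [h] with ω hω
  rw [energy_congr hω]

theorem mem_processSpace_congr (hβ : 1 < β) (hX : X ∈ processSpace Q hβ)
    (h : ∀ t ∈ Icc 0 T, ∀ ω, X t ω = Y t ω) : Y ∈ processSpace Q hβ := by
  refine ⟨hX.1.congr h, ?_, ?_⟩
  · filter_upwards [hX.2.1] with ω hω
    rwa [energy_congr (Y := X) fun t ht => (h t ht ω).symm]
  · rw [betaNorm_congr (Y := X) (Eventually.of_forall fun ω t ht => (h t ht ω).symm)]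
    exact hX.2.2

/-- Finiteness of the energy almost surely is automatic, since a power of it has finite expectation.
-/
theorem mem_processSpace (hβ : 1 < β) (hX : IsProgressiveOn F T X) (h : betaNorm Q β X < ∞) :
    X ∈ processSpace Q hβ := by
  have hb : 0 < β := by linarith
  refine ⟨hX, ?_, h⟩
  rw [betaNorm, ENNReal.rpow_lt_top_iff_of_pos (by positivity)] at h
  filter_upwards [ae_lt_top ((measurable_energy Q hX).pow_const β) h.ne] with ω hω
  exact (ENNReal.rpow_lt_top_iff_of_pos hb).1 hω

theorem energy_eq_of_clock_eq {ω : Ω} (h : clock Q ω = volume.restrict (Ioc 0 T)) :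
    energy Q X ω = ∫⁻ t in Ioc 0 T, ‖X t ω‖ₑ ^ 2 := by
  rw [← h]
  rfl

theorem IsProgressiveOn.aemeasurable (hX : IsProgressiveOn F T X) (ω : Ω) :
    AEMeasurable (fun t => X t ω) (volume.restrict (Ioc 0 T)) := by
  refine ⟨_, hX.measurable_indicator.comp (measurable_prodMk_left (x := ω)), ?_⟩
  refine (ae_restrict_iff' measurableSet_Ioc).2 (Eventually.of_forall fun t ht => ?_)
  simp [indicator_of_mem (Ioc_subset_Icc_self ht)]

/-- Hölder on an interval of length `T`: the `L²` norm is compared with the `L^(2β)` norm, and both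
sides are raised to the power `2β`. -/
theorem lintegral_sq_rpow_le {T : ℝ} (hβ : 1 < β) {f : ℝ → ℝ}
    (hf : AEMeasurable f (volume.restrict (Ioc 0 T))) :
    (∫⁻ t in Ioc 0 T, ‖f t‖ₑ ^ 2) ^ β ≤
      ENNReal.ofReal T ^ (β - 1) * ∫⁻ t in Ioc 0 T, ‖f t‖ₑ ^ (2 * β) := by
  have hb : 0 < β := by linarith
  have h := eLpNorm'_le_eLpNorm'_mul_rpow_measure_univ (p := 2) (q := 2 * β) two_pos
    (by linarith) hf.aestronglyMeasurable
  rw [Measure.restrict_apply_univ, Real.volume_Ioc, sub_zero, eLpNorm', eLpNorm'] at h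
  simp only [ENNReal.rpow_ofNat] at h
  have h2 := ENNReal.rpow_le_rpow h (by positivity : 0 ≤ 2 * β)
  rw [ENNReal.mul_rpow_of_nonneg _ _ (by positivity), ← ENNReal.rpow_mul, ← ENNReal.rpow_mul,
    ← ENNReal.rpow_mul] at h2
  have e1 : 1 / 2 * (2 * β) = β := by ring
  have e2 : 1 / (2 * β) * (2 * β) = 1 := by field_simp
  have e3 : (1 / 2 - 1 / (2 * β)) * (2 * β) = β - 1 := by field_simp
  rw [e1, e2, e3, ENNReal.rpow_one] at h2
  rwa [mul_comm]

theorem lintegral_enorm_sq_le {T : ℝ} {f : ℝ → ℝ}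
    (hf : AEMeasurable f (volume.restrict (Ioc 0 T))) :
    (∫⁻ t in Ioc 0 T, ‖f t‖ₑ) ^ 2 ≤ ENNReal.ofReal T * ∫⁻ t in Ioc 0 T, ‖f t‖ₑ ^ 2 := by
  have h := eLpNorm'_le_eLpNorm'_mul_rpow_measure_univ (p := 1) (q := 2) one_pos
    one_le_two hf.aestronglyMeasurable
  rw [Measure.restrict_apply_univ, Real.volume_Ioc, sub_zero, eLpNorm', eLpNorm'] at h
  simp only [ENNReal.rpow_ofNat, ENNReal.rpow_one, div_one] at h
  have h2 := pow_le_pow_left₀ zero_le h 2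
  rw [mul_pow, ← ENNReal.rpow_natCast, ← ENNReal.rpow_natCast, ← ENNReal.rpow_natCast,
    ← ENNReal.rpow_mul, ← ENNReal.rpow_mul] at h2
  norm_num at h2
  rwa [mul_comm]

/-- Once the clock is Lebesgue measure, Hölder in time and Tonelli bound the expectation of the
`β`-th power of the energy by `T ^ (β - 1)` times the time integral of the `2β`-th moments. -/
theorem betaNorm_le_of_eLpNorm_le (hβ : 1 < β)
    (hclock : ∀ᵐ ω ∂P, clock Q ω = volume.restrict (Ioc 0 T)) [SFinite P]
    (hX : IsProgressiveOn F T X) {c : ℝ≥0∞}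
    (hc : ∀ t ∈ Icc 0 T, eLpNorm (X t) (ENNReal.ofReal (2 * β)) P ≤ c) :
    betaNorm Q β X ≤ ENNReal.ofReal T ^ (1 / 2 : ℝ) * c := by
  have hb : 0 < β := by linarith
  have hmom : ∀ t ∈ Icc 0 T, ∫⁻ ω, ‖X t ω‖ₑ ^ (2 * β) ∂P ≤ c ^ (2 * β) := by
    intro t ht
    have h := ENNReal.rpow_le_rpow (hc t ht) (by positivity : 0 ≤ 2 * β)
    rw [eLpNorm_eq_lintegral_rpow_enorm_toReal (by simp [hb]) ENNReal.ofReal_ne_top,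
      ENNReal.toReal_ofReal (by positivity), ← ENNReal.rpow_mul] at h
    have e2 : 1 / (2 * β) * (2 * β) = 1 := by field_simp
    rwa [e2, ENNReal.rpow_one] at h
  have hmeas : Measurable fun p : Ω × ℝ =>
      ‖(Icc 0 T).indicator (fun t => X t p.1) p.2‖ₑ ^ (2 * β) :=
    hX.measurable_indicator.enorm.pow_const _
  have hE : ∫⁻ ω, energy Q X ω ^ β ∂P ≤
      ENNReal.ofReal T ^ β * c ^ (2 * β) := by
    calc ∫⁻ ω, energy Q X ω ^ β ∂P
        ≤ ∫⁻ ω, ENNReal.ofReal T ^ (β - 1) * (∫⁻ t in Ioc 0 T,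
            ‖(Icc 0 T).indicator (fun t => X t ω) t‖ₑ ^ (2 * β)) ∂P := by
          refine lintegral_mono_ae ?_
          filter_upwards [hclock] with ω hω
          rw [energy_eq_of_clock_eq hω]
          refine (lintegral_sq_rpow_le hβ (hX.aemeasurable ω)).trans_eq ?_
          congr 1
          refine setLIntegral_congr_fun measurableSet_Ioc fun t ht => ?_
          simp only [indicator_of_mem (Ioc_subset_Icc_self ht)]
      _ = ENNReal.ofReal T ^ (β - 1) * ∫⁻ ω, (∫⁻ t in Ioc 0 T,
            ‖(Icc 0 T).indicator (fun t => X t ω) t‖ₑ ^ (2 * β)) ∂P :=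
          lintegral_const_mul' _ _ (ENNReal.rpow_ne_top_of_nonneg (by linarith)
            ENNReal.ofReal_ne_top)
      _ = ENNReal.ofReal T ^ (β - 1) * ∫⁻ t in Ioc 0 T, ∫⁻ ω,
            ‖(Icc 0 T).indicator (fun t => X t ω) t‖ₑ ^ (2 * β) ∂P := by
          rw [lintegral_lintegral_swap hmeas.aemeasurable]
      _ ≤ ENNReal.ofReal T ^ (β - 1) * ∫⁻ _ in Ioc 0 T, c ^ (2 * β) := by
          refine mul_le_mul_right ?_ _
          refine setLIntegral_mono measurable_const fun t ht => ?_
          have ht' := Ioc_subset_Icc_self ht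
          simp only [indicator_of_mem ht']
          exact hmom t ht'
      _ = ENNReal.ofReal T ^ β * c ^ (2 * β) := by
          rw [setLIntegral_const, Real.volume_Ioc, sub_zero, mul_comm (c ^ (2 * β)), ← mul_assoc]
          congr 1
          nth_rewrite 2 [← ENNReal.rpow_one (ENNReal.ofReal T)]
          rw [← ENNReal.rpow_add_of_nonneg _ _ (by linarith) zero_le_one, sub_add_cancel]
  refine (ENNReal.rpow_le_rpow hE (by positivity)).trans_eq ?_
  rw [ENNReal.mul_rpow_of_nonneg _ _ (by positivity), ← ENNReal.rpow_mul, ← ENNReal.rpow_mul]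
  have e1 : β * (1 / (2 * β)) = 1 / 2 := by field_simp
  have e2 : 2 * β * (1 / (2 * β)) = 1 := by field_simp
  rw [e1, e2, ENNReal.rpow_one]

/-- The two exponentials combine to `exp (-α (t - u)) ≤ 1` for `u ≤ t`. Integrability is not
required: the bound also holds when the Bochner integral takes its default value `0`. -/
theorem enorm_derivProcess_le {α : ℝ} (hα : 0 ≤ α) {ω : Ω} {t : ℝ} (ht : t ∈ Icc 0 T) :
    ‖(derivProcess α X) t ω‖ₑ ≤
      ‖X t ω‖ₑ + ENNReal.ofReal α * ∫⁻ u in Ioc 0 T, ‖X u ω‖ₑ := by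
  rw [derivProcess]
  refine (enorm_sub_le).trans (add_le_add le_rfl ?_)
  rw [mul_assoc, enorm_mul, Real.enorm_of_nonneg hα]
  gcongr
  rw [← intervalIntegral.integral_const_mul, intervalIntegral.integral_of_le ht.1]
  refine (enorm_integral_le_lintegral_enorm _).trans ?_
  refine (setLIntegral_mono' measurableSet_Ioc fun u hu => ?_).trans
    (lintegral_mono_set (Ioc_subset_Ioc_right ht.2))
  rw [mul_left_comm, ← Real.exp_add, enorm_mul]
  refine mul_le_of_le_one_right' ?_
  rw [Real.enorm_of_nonneg (Real.exp_pos _).le]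
  refine ENNReal.ofReal_le_one.2 (Real.exp_le_one_iff.2 ?_)
  nlinarith [hu.2]

/-- From `(x + y)² ≤ 2 x² + 2 y²` together with Cauchy–Schwarz for the integral term; the two
factors `T` come from Cauchy–Schwarz and from integrating a constant over `(0, T]`. -/
theorem energy_derivProcess_le {α : ℝ} (hα : 0 ≤ α) (hX : IsProgressiveOn F T X) {ω : Ω}
    (h : clock Q ω = volume.restrict (Ioc 0 T)) :
    energy Q (derivProcess α X) ω ≤
      (2 + 2 * ENNReal.ofReal (α * T) ^ 2) * energy Q X ω := by
  rw [energy_eq_of_clock_eq h, energy_eq_of_clock_eq h]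
  set I := ∫⁻ u in Ioc 0 T, ‖X u ω‖ₑ with hI
  set S := ∫⁻ t in Ioc 0 T, ‖X t ω‖ₑ ^ 2 with hS
  have hIS : I ^ 2 ≤ ENNReal.ofReal T * S := lintegral_enorm_sq_le (hX.aemeasurable ω)
  have hm : AEMeasurable (fun t => 2 * ‖X t ω‖ₑ ^ 2) (volume.restrict (Ioc 0 T)) :=
    ((hX.aemeasurable ω).enorm.pow_const 2).const_mul 2
  calc ∫⁻ t in Ioc 0 T, ‖(derivProcess α X) t ω‖ₑ ^ 2
      ≤ ∫⁻ t in Ioc 0 T, (2 * ‖X t ω‖ₑ ^ 2 + 2 * (ENNReal.ofReal α * I) ^ 2) := by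
        refine setLIntegral_mono' measurableSet_Ioc fun t ht => ?_
        refine (pow_le_pow_left₀ zero_le
          (enorm_derivProcess_le hα (Ioc_subset_Icc_self ht)) 2).trans ?_
        have h2 := ENNReal.rpow_add_le_mul_rpow_add_rpow ‖X t ω‖ₑ (ENNReal.ofReal α * I)
          one_le_two
        rw [← mul_add]
        norm_num at h2
        exact h2
    _ = 2 * S + 2 * (ENNReal.ofReal α * I) ^ 2 * ENNReal.ofReal T := by
        rw [lintegral_add_left' hm, setLIntegral_const, Real.volume_Ioc, sub_zero,
          lintegral_const_mul' _ _ ENNReal.ofNat_ne_top]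
    _ ≤ 2 * S + 2 * (ENNReal.ofReal α ^ 2 * (ENNReal.ofReal T * S)) * ENNReal.ofReal T := by
        rw [mul_pow]
        gcongr
    _ = _ := by
        rw [ENNReal.ofReal_mul hα]
        ring

theorem betaNorm_derivProcess_le {α : ℝ} (hα : 0 ≤ α) (hβ : 1 < β)
    (hclock : ∀ᵐ ω ∂P, clock Q ω = volume.restrict (Ioc 0 T)) (hX : IsProgressiveOn F T X) :
    betaNorm Q β (derivProcess α X) ≤
      (2 + 2 * ENNReal.ofReal (α * T) ^ 2) ^ (1 / 2 : ℝ) * betaNorm Q β X := by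
  have hb : 0 < β := by linarith
  rw [betaNorm, betaNorm]
  have h1 : ∫⁻ ω, energy Q (derivProcess α X) ω ^ β ∂P ≤
      (2 + 2 * ENNReal.ofReal (α * T) ^ 2) ^ β * ∫⁻ ω, energy Q X ω ^ β ∂P := by
    rw [← lintegral_const_mul' _ _ (ENNReal.rpow_ne_top_of_nonneg hb.le (by finiteness))]
    refine lintegral_mono_ae ?_
    filter_upwards [hclock] with ω hω
    rw [← ENNReal.mul_rpow_of_nonneg _ _ hb.le]
    exact ENNReal.rpow_le_rpow (energy_derivProcess_le hα hX hω) hb.le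
  refine (ENNReal.rpow_le_rpow h1 (by positivity)).trans_eq ?_
  rw [ENNReal.mul_rpow_of_nonneg _ _ (by positivity), ← ENNReal.rpow_mul]
  congr 2
  field_simp

theorem ae_intervalIntegrable_mul (hT : 0 ≤ T) {hβ : 1 < β}
    (hclock : ∀ᵐ ω ∂P, clock Q ω = volume.restrict (Ioc 0 T)) (hX : X ∈ processSpace Q hβ)
    {g : ℝ → ℝ} (hg : Continuous g) :
    ∀ᵐ ω ∂P, IntervalIntegrable (fun u => X u ω * g u) volume 0 T := by
  filter_upwards [hclock, hX.2.1] with ω h1 h2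
  rw [energy_eq_of_clock_eq h1] at h2
  have h3 : IntervalIntegrable (fun u => X u ω) volume 0 T := by
    rw [intervalIntegrable_iff_integrableOn_Ioc_of_le hT]
    refine ⟨(hX.1.aemeasurable ω).aestronglyMeasurable, ?_⟩
    have h4 := (lintegral_enorm_sq_le (hX.1.aemeasurable ω)).trans_lt
      (ENNReal.mul_lt_top ENNReal.ofReal_lt_top h2)
    exact (ENNReal.pow_lt_top_iff.1 h4).resolve_right two_ne_zero
  exact h3.mul_continuousOn hg.continuousOn

end Norm

/-! ### The progressively measurable version of the derivative process -/

section Main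

variable {Ω : Type*} {m : MeasurableSpace Ω} {P : Measure Ω} {W : ℝ → Ω → ℝ} {B : ℝ≥0 → Ω → ℝ}
  {hWm : ∀ t, Measurable (W t)} {hBm : ∀ t, Measurable (B t)} {T : ℝ} {M : ℝ → Ω → ℝ}
  {BH : ℝ → ℝ → Ω → ℝ}

theorem IsWienerIntegral.const_mul (hW : IsFractionalBrownianMotion (1 / 2) W P) {f : ℝ → ℝ}
    {X : Ω → ℝ} (hf : IsWienerIntegral W P f X) (r : ℝ) :
    IsWienerIntegral W P (fun s => r * f s) fun ω => r * X ω := by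
  have h := hf.add_const_mul hW hf (r - 1)
  have e1 : (fun s => f s + (r - 1) * f s) = fun s => r * f s := funext fun s => by ring
  have e2 : (fun ω => X ω + (r - 1) * X ω) = fun ω => r * X ω := funext fun ω => by ring
  rwa [e1, e2] at h

theorem isProgressiveOn_of_isWienerIntegral_kernel [P.IsComplete]
    (hW : IsFractionalBrownianMotion (1 / 2) W P) {H : ℝ} {X : ℝ → Ω → ℝ}
    (hc : ∀ ω, Continuous fun t => X t ω)
    (hrep : ∀ t, 0 ≤ t → IsWienerIntegral W P (kernel H t) (X t)) :
    IsProgressiveOn (completedFiltration P W B hWm hBm) T X :=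
  isProgressiveOn_of_continuous hc fun t ht =>
    (hrep t ht.1).measurable_completedFiltration hWm hBm hW fun _ hs => kernel_of_le H ht.1 hs.le

theorem ae_eq_zero_of_isWienerIntegral_kernel_zero (hW : IsFractionalBrownianMotion (1 / 2) W P)
    {H : ℝ} {X : Ω → ℝ} (h : IsWienerIntegral W P (kernel H 0) X) : X =ᵐ[P] 0 := by
  have h1 := h.eLpNorm_two_le hW
  have e : kernel H 0 = 0 := by
    funext s
    simp [kernel]
  rw [e, eLpNorm_zero, nonpos_iff_eq_zero] at h1
  exact (eLpNorm_eq_zero_iff h.2.1.1 two_ne_zero).1 h1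

theorem isWienerIntegral_kernel_remainder (hW : IsFractionalBrownianMotion (1 / 2) W P)
    {H h t : ℝ} {X X' Y : Ω → ℝ} (hX : IsWienerIntegral W P (kernel h t) X)
    (hX' : IsWienerIntegral W P (kernel H t) X') (hY : IsWienerIntegral W P (kernelDeriv H t) Y) :
    IsWienerIntegral W P (fun s => kernel h t s - kernel H t s - (h - H) * kernelDeriv H t s)
      fun ω => X ω - X' ω - (h - H) * Y ω := by
  have key := (hX.add_const_mul hW hX' (-1)).add_const_mul hW hY (-(h - H))
  have e : ∀ a b c : ℝ, a + -1 * b + -(h - H) * c = a - b - (h - H) * c := fun a b c => by ring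
  simpa only [e] using key

/-- The difference quotients `X n` of `H ↦ B^H` are progressive and converge in `L²` at a geometric
rate uniform in `t`. One sequence of increments thus gives almost sure convergence at every `t`, and
the limsup over it defines a single progressive process. -/
theorem exists_isProgressiveOn_isWienerIntegral_kernelDeriv [P.IsComplete]
    (hW : IsFractionalBrownianMotion (1 / 2) W P) (hT : 0 ≤ T)
    (hc : ∀ H ∈ Ioo (0 : ℝ) 1, ∀ ω, Continuous fun t => BH H t ω)
    (hrep : ∀ H ∈ Ioo (0 : ℝ) 1, ∀ t, 0 ≤ t → IsWienerIntegral W P (kernel H t) (BH H t))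
    {H : ℝ} (hH : H ∈ Ioo (0 : ℝ) 1) :
    ∃ Y : ℝ → Ω → ℝ, IsProgressiveOn (completedFiltration P W B hWm hBm) T Y ∧
      ∀ t ∈ Icc 0 T, IsWienerIntegral W P (kernelDeriv H t) (Y t) := by
  choose δ hδ hδ' using fun n : ℕ => eLpNorm_kernel_sub_le hH hT
    (η := (1 / 2 : ℝ) ^ n) (by positivity)
  -- Halving makes the increment strictly smaller than both numbers: the kernel estimate applies and
  -- `H + ε n` stays in `(0, 1)`.
  let ε : ℕ → ℝ := fun n => min (δ n) (1 - H) / 2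
  have hε : ∀ n, 0 < ε n := fun n => half_pos (lt_min (hδ n) (sub_pos.2 hH.2))
  have hε1 : ∀ n, ε n < δ n := fun n =>
    (half_lt_self (lt_min (hδ n) (sub_pos.2 hH.2))).trans_le (min_le_left _ _)
  have hε2 : ∀ n, ε n < 1 - H := fun n =>
    (half_lt_self (lt_min (hδ n) (sub_pos.2 hH.2))).trans_le (min_le_right _ _)
  have hmem : ∀ n, H + ε n ∈ Ioo (0 : ℝ) 1 := fun n =>
    ⟨by linarith [hH.1, hε n], by linarith [hε2 n]⟩
  let f : ℕ → ℝ → ℝ → ℝ := fun n t s => (ε n)⁻¹ * (kernel (H + ε n) t s + -1 * kernel H t s)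
  let X : ℕ → ℝ → Ω → ℝ := fun n t ω => (ε n)⁻¹ * (BH (H + ε n) t ω + -1 * BH H t ω)
  have hfX : ∀ n t, 0 ≤ t → IsWienerIntegral W P (f n t) (X n t) := fun n t ht =>
    ((hrep _ (hmem n) t ht).add_const_mul hW (hrep H hH t ht) (-1)).const_mul hW _
  have hf : ∀ n, ∀ t ∈ Icc 0 T, eLpNorm (fun s => f n t s - kernelDeriv H t s) 2 volume ≤
      ENNReal.ofReal ((1 / 2 : ℝ) ^ n) := by
    intro n t ht
    have h := hδ' n (H + ε n) (by rw [add_sub_cancel_left, abs_of_pos (hε n)]; exact hε1 n) t ht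
    rw [add_sub_cancel_left, abs_of_pos (hε n)] at h
    have e : (fun s => f n t s - kernelDeriv H t s) = (ε n)⁻¹ • fun s =>
        kernel (H + ε n) t s - kernel H t s - ε n * kernelDeriv H t s := by
      funext s
      have := (hε n).ne'
      simp only [f, Pi.smul_apply, smul_eq_mul]
      field_simp
      ring
    rw [e, eLpNorm_const_smul, Real.enorm_of_nonneg (inv_pos.2 (hε n)).le]
    refine (mul_le_mul_right h _).trans_eq ?_
    rw [← ENNReal.ofReal_mul (inv_pos.2 (hε n)).le]
    congr 1
    have := (hε n).ne'
    field_simp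
  -- Two quotients with indices at least `N` differ by at most `2 (1/2)^N`; the larger constant `4`
  -- gives the strict inequality wanted by the summable Cauchy criterion for almost sure
  -- convergence.
  have hB : ∑' n : ℕ, ENNReal.ofReal (4 * (1 / 2 : ℝ) ^ n) ≠ ∞ :=
    (summable_geometric_two.mul_left 4).tsum_ofReal_ne_top
  have hcau : ∀ t ∈ Icc 0 T, ∀ N n k : ℕ, N ≤ n → N ≤ k →
      eLpNorm (X n t - X k t) 2 P < ENNReal.ofReal (4 * (1 / 2 : ℝ) ^ N) := by
    intro t ht N n k hn hk
    have h1 := ((hfX n t ht.1).add_const_mul hW (hfX k t ht.1) (-1)).eLpNorm_two_le hW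
    have e1 : (fun ω => X n t ω + -1 * X k t ω) = X n t - X k t := by
      funext ω
      simp [sub_eq_add_neg]
    have e2 : (fun s => f n t s + -1 * f k t s) =
        (fun s => f n t s - kernelDeriv H t s) - fun s => f k t s - kernelDeriv H t s := by
      funext s
      simp only [Pi.sub_apply]
      ring
    have hD := memLp_kernelDeriv hH ht.1
    rw [e1, e2] at h1
    refine h1.trans_lt (lt_of_le_of_lt (eLpNorm_sub_le ((hfX n t ht.1).1.sub hD).1
      ((hfX k t ht.1).1.sub hD).1 one_le_two) ?_)
    have hpow : ∀ j, N ≤ j → ENNReal.ofReal ((1 / 2 : ℝ) ^ j) ≤ ENNReal.ofReal ((1 / 2 : ℝ) ^ N) :=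
      fun j hj => ENNReal.ofReal_le_ofReal
        (pow_le_pow_of_le_one (by norm_num) (by norm_num) hj)
    refine lt_of_le_of_lt (add_le_add ((hf n t ht).trans (hpow n hn))
      ((hf k t ht).trans (hpow k hk))) ?_
    rw [← ENNReal.ofReal_add (by positivity) (by positivity)]
    have hp : (0 : ℝ) < (1 / 2) ^ N := by positivity
    exact (ENNReal.ofReal_lt_ofReal_iff (by positivity)).2 (by linarith)
  refine ⟨fun t ω => limsup (fun n => X n t ω) atTop, isProgressiveOn_limsup fun n => ?_,
    fun t ht => ?_⟩
  · have h1 := isProgressiveOn_of_isWienerIntegral_kernel (hWm := hWm) (hBm := hBm) (T := T) hW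
      (hc _ (hmem n)) (hrep _ (hmem n))
    have h2 := isProgressiveOn_of_isWienerIntegral_kernel (hWm := hWm) (hBm := hBm) (T := T) hW
      (hc H hH) (hrep H hH)
    exact fun t ht => ((h1 t ht).add ((h2 t ht).const_mul (-1))).const_mul _
  · have hmeas : ∀ n, AEStronglyMeasurable (X n t) P := fun n => (hfX n t ht.1).2.1.1
    have hlim : ∀ᵐ ω ∂P, Tendsto (fun n => X n t ω) atTop
        (𝓝 (limsup (fun n => X n t ω) atTop)) := by
      filter_upwards [Lp.ae_tendsto_of_cauchy_eLpNorm hmeas one_le_two hB (hcau t ht)] with ω hω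
      obtain ⟨l, hl⟩ := hω
      rwa [hl.limsup_eq]
    have hL2 := Lp.cauchy_tendsto_of_tendsto hmeas _ hB (hcau t ht) hlim
    have hY := Lp.memLp_of_cauchy_tendsto one_le_two (fun n => (hfX n t ht.1).2.1) _
      (aestronglyMeasurable_of_tendsto_ae atTop hmeas hlim) hL2
    refine IsWienerIntegral.of_tendsto hW (fun n => hfX n t ht.1) (memLp_kernelDeriv hH ht.1) hY
      ?_ hL2
    refine tendsto_of_tendsto_of_tendsto_of_le_of_le tendsto_const_nhds ?_ (fun _ => zero_le)
      fun n => hf n t ht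
    rw [← ENNReal.ofReal_zero]
    exact ENNReal.tendsto_ofReal (tendsto_pow_atTop_nhds_zero_of_lt_one (by norm_num)
      (by norm_num))

/-! ### The fractional Ornstein–Uhlenbeck process in `𝓓_β` -/

variable {Q : QuadraticVariation P (completedFiltration P W B hWm hBm) T M} {β : ℝ}

/-- A constant which controls the norm of `derivProcess α X` in `𝓓_β` in terms of the kernel of a
process of Wiener integrals `X`. -/
noncomputable def derivBound (α β T : ℝ) : ℝ≥0∞ :=
  (2 + 2 * ENNReal.ofReal (α * T) ^ 2) ^ (1 / 2 : ℝ) *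
    (ENNReal.ofReal T ^ (1 / 2 : ℝ) * gaussianLpConst (ENNReal.ofReal (2 * β)))

theorem derivBound_lt_top (α β T : ℝ) : derivBound α β T < ∞ := by
  refine ENNReal.mul_lt_top (ENNReal.rpow_lt_top_of_nonneg (by norm_num) (by finiteness))
    (ENNReal.mul_lt_top (ENNReal.rpow_lt_top_of_nonneg (by norm_num) ENNReal.ofReal_ne_top)
      (gaussianLpConst_lt_top ENNReal.ofReal_ne_top))

theorem betaNorm_le_of_isWienerIntegral (hW : IsFractionalBrownianMotion (1 / 2) W P)
    (hβ : 1 < β) (hclock : ∀ᵐ ω ∂P, clock Q ω = volume.restrict (Ioc 0 T)) {X : ℝ → Ω → ℝ}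
    (hX : IsProgressiveOn (completedFiltration P W B hWm hBm) T X) {f : ℝ → ℝ → ℝ}
    (hf : ∀ t ∈ Icc 0 T, IsWienerIntegral W P (f t) (X t)) {A : ℝ≥0∞}
    (hA : ∀ t ∈ Icc 0 T, eLpNorm (f t) 2 volume ≤ A) :
    betaNorm Q β X ≤
      ENNReal.ofReal T ^ (1 / 2 : ℝ) * gaussianLpConst (ENNReal.ofReal (2 * β)) * A := by
  have hP := hW.gaussian.isProbabilityMeasure
  rw [mul_assoc]
  refine betaNorm_le_of_eLpNorm_le hβ hclock hX fun t ht => ?_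
  exact ((hf t ht).eLpNorm_le hW ENNReal.ofReal_ne_top).trans (mul_le_mul_right (hA t ht) _)

theorem betaNorm_derivProcess_le_of_isWienerIntegral
    (hW : IsFractionalBrownianMotion (1 / 2) W P) {α : ℝ} (hα : 0 ≤ α)
    (hβ : 1 < β) (hclock : ∀ᵐ ω ∂P, clock Q ω = volume.restrict (Ioc 0 T)) {X : ℝ → Ω → ℝ}
    (hX : IsProgressiveOn (completedFiltration P W B hWm hBm) T X) {f : ℝ → ℝ → ℝ}
    (hf : ∀ t ∈ Icc 0 T, IsWienerIntegral W P (f t) (X t)) {A : ℝ≥0∞}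
    (hA : ∀ t ∈ Icc 0 T, eLpNorm (f t) 2 volume ≤ A) :
    betaNorm Q β (derivProcess α X) ≤ derivBound α β T * A := by
  refine (betaNorm_derivProcess_le hα hβ hclock hX).trans ?_
  rw [derivBound, mul_assoc]
  exact mul_le_mul_right (betaNorm_le_of_isWienerIntegral hW hβ hclock hX hf hA) _

theorem mem_processSpace_of_isWienerIntegral (hW : IsFractionalBrownianMotion (1 / 2) W P)
    (hβ : 1 < β) (hclock : ∀ᵐ ω ∂P, clock Q ω = volume.restrict (Ioc 0 T)) {X : ℝ → Ω → ℝ}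
    (hX : IsProgressiveOn (completedFiltration P W B hWm hBm) T X) {f : ℝ → ℝ → ℝ}
    (hf : ∀ t ∈ Icc 0 T, IsWienerIntegral W P (f t) (X t)) {A : ℝ≥0}
    (hA : ∀ t ∈ Icc 0 T, eLpNorm (f t) 2 volume ≤ A) : X ∈ processSpace Q hβ := by
  refine mem_processSpace hβ hX
    ((betaNorm_le_of_isWienerIntegral hW hβ hclock hX hf hA).trans_lt ?_)
  exact ENNReal.mul_lt_top (ENNReal.mul_lt_top
    (ENNReal.rpow_lt_top_of_nonneg (by norm_num) ENNReal.ofReal_ne_top)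
    (gaussianLpConst_lt_top ENNReal.ofReal_ne_top)) ENNReal.coe_lt_top

theorem derivProcess_mem_processSpace_of_isWienerIntegral
    (hW : IsFractionalBrownianMotion (1 / 2) W P) {α : ℝ} (hα : 0 ≤ α)
    (hβ : 1 < β) (hclock : ∀ᵐ ω ∂P, clock Q ω = volume.restrict (Ioc 0 T)) {X : ℝ → Ω → ℝ}
    (hX : IsProgressiveOn (completedFiltration P W B hWm hBm) T X) {f : ℝ → ℝ → ℝ}
    (hf : ∀ t ∈ Icc 0 T, IsWienerIntegral W P (f t) (X t)) {A : ℝ≥0}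
    (hA : ∀ t ∈ Icc 0 T, eLpNorm (f t) 2 volume ≤ A) : derivProcess α X ∈ processSpace Q hβ :=
  mem_processSpace hβ (hX.derivProcess α)
    ((betaNorm_derivProcess_le_of_isWienerIntegral hW hα hβ hclock hX hf hA).trans_lt
      (ENNReal.mul_lt_top (derivBound_lt_top α β T) ENNReal.coe_lt_top))

theorem ornsteinUhlenbeck_mem_processSpace [P.IsComplete]
    (hW : IsFractionalBrownianMotion (1 / 2) W P) (hT : 0 ≤ T) {α : ℝ} (hα : 0 ≤ α) (hβ : 1 < β)
    (hclock : ∀ᵐ ω ∂P, clock Q ω = volume.restrict (Ioc 0 T)) {lam0 : Ω → ℝ}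
    (hlam0 : Measurable[completedFiltration P W B hWm hBm 0] lam0)
    (hlam0' : MemLp lam0 (ENNReal.ofReal (2 * β)) P) {H : ℝ} (hH : H ∈ Ioo (0 : ℝ) 1)
    {X : ℝ → Ω → ℝ} (hc : ∀ ω, Continuous fun t => X t ω)
    (hrep : ∀ t, 0 ≤ t → IsWienerIntegral W P (kernel H t) (X t)) :
    ornsteinUhlenbeck α lam0 X ∈ processSpace Q hβ := by
  have hP := hW.gaussian.isProbabilityMeasure
  have hX := isProgressiveOn_of_isWienerIntegral_kernel (hWm := hWm) (hBm := hBm) (T := T) hW hc hrep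
  obtain ⟨A, hA⟩ := exists_eLpNorm_kernel_le hH hT
  have h1 := derivProcess_mem_processSpace_of_isWienerIntegral hW hα hβ hclock hX
    (fun t ht => hrep t ht.1) hA
  have hX0 : Measurable[completedFiltration P W B hWm hBm 0] (X 0) :=
    (hrep 0 le_rfl).measurable_completedFiltration hWm hBm hW fun s hs => kernel_of_le H le_rfl hs.le
  have hLp : MemLp (lam0 - X 0) (ENNReal.ofReal (2 * β)) P := by
    refine hlam0'.sub ⟨(hrep 0 le_rfl).2.1.1, ?_⟩
    exact ((hrep 0 le_rfl).eLpNorm_le hW ENNReal.ofReal_ne_top).trans_lt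
      (ENNReal.mul_lt_top (gaussianLpConst_lt_top ENNReal.ofReal_ne_top) (hrep 0 le_rfl).1.2)
  have hprog : IsProgressiveOn (completedFiltration P W B hWm hBm) T
      fun t ω => Real.exp (-α * t) * (lam0 ω - X 0 ω) := by
    refine isProgressiveOn_of_continuous (fun ω => by fun_prop) fun t ht => ?_
    exact ((hlam0.sub hX0).const_mul _).mono ((completedFiltration P W B hWm hBm).mono ht.1) le_rfl
  have h2 : (fun t ω => Real.exp (-α * t) * (lam0 ω - X 0 ω)) ∈ processSpace Q hβ := by
    refine mem_processSpace hβ hprog ((betaNorm_le_of_eLpNorm_le hβ hclock hprog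
      (c := eLpNorm (lam0 - X 0) (ENNReal.ofReal (2 * β)) P) fun t ht => ?_).trans_lt ?_)
    · refine eLpNorm_mono fun ω => ?_
      rw [norm_mul, Real.norm_of_nonneg (Real.exp_pos _).le]
      refine mul_le_of_le_one_left (norm_nonneg _) (Real.exp_le_one_iff.2 ?_)
      nlinarith [ht.1]
    · exact ENNReal.mul_lt_top (ENNReal.rpow_lt_top_of_nonneg (by norm_num) ENNReal.ofReal_ne_top)
        hLp.2
  exact mem_processSpace_congr hβ (add_mem h2 h1) fun t ht ω =>
    (ornsteinUhlenbeck_eq hα lam0 (hc ω) ht.1).symm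

theorem derivProcess_sub_sub {X X' Y : ℝ → Ω → ℝ} {α r : ℝ} {ω : Ω} {t : ℝ}
    (hX : IntervalIntegrable (fun u => X u ω * Real.exp (α * u)) volume 0 t)
    (hX' : IntervalIntegrable (fun u => X' u ω * Real.exp (α * u)) volume 0 t)
    (hY : IntervalIntegrable (fun u => Y u ω * Real.exp (α * u)) volume 0 t) :
    derivProcess α (fun t ω => X t ω - X' t ω - r * Y t ω) t ω =
      derivProcess α X t ω - derivProcess α X' t ω - r * derivProcess α Y t ω := by
  have e : ∀ u, (X u ω - X' u ω - r * Y u ω) * Real.exp (α * u) =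
      X u ω * Real.exp (α * u) - X' u ω * Real.exp (α * u) - r * (Y u ω * Real.exp (α * u)) :=
    fun u => by ring
  simp only [derivProcess, e]
  rw [intervalIntegral.integral_sub (hX.sub hX') (hY.const_mul r),
    intervalIntegral.integral_sub hX hX', intervalIntegral.integral_const_mul]
  ring

/-- The initial terms cancel because `lam0` is common and both drivers vanish at time `0` almost
surely. The rest is pathwise linearity, so one null set serves all `t`; integrability of `Y` is
needed for additivity of the integral. -/
theorem ae_ornsteinUhlenbeck_sub_sub_eq (hW : IsFractionalBrownianMotion (1 / 2) W P) {α : ℝ}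
    (hα : 0 ≤ α) (lam0 : Ω → ℝ) {H h r : ℝ} {X X' Y : ℝ → Ω → ℝ}
    (hXc : ∀ ω, Continuous fun t => X t ω) (hXc' : ∀ ω, Continuous fun t => X' t ω)
    (hX : IsWienerIntegral W P (kernel h 0) (X 0)) (hX' : IsWienerIntegral W P (kernel H 0) (X' 0))
    (hY : ∀ᵐ ω ∂P, IntervalIntegrable (fun u => Y u ω * Real.exp (α * u)) volume 0 T) :
    ∀ᵐ ω ∂P, ∀ t ∈ Icc 0 T,
      (ornsteinUhlenbeck α lam0 X - ornsteinUhlenbeck α lam0 X' - r • derivProcess α Y) t ω =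
        derivProcess α (fun t ω => X t ω - X' t ω - r * Y t ω) t ω := by
  filter_upwards [ae_eq_zero_of_isWienerIntegral_kernel_zero hW hX,
    ae_eq_zero_of_isWienerIntegral_kernel_zero hW hX', hY] with ω h1 h2 h3 t ht
  have hsub : uIcc 0 t ⊆ uIcc 0 T := uIcc_subset_uIcc_left (by
    rw [uIcc_of_le (ht.1.trans ht.2)]
    exact ht)
  have hexp : Continuous fun u => Real.exp (α * u) := by fun_prop
  rw [derivProcess_sub_sub (((hXc ω).mul hexp).intervalIntegrable 0 t)
    (((hXc' ω).mul hexp).intervalIntegrable 0 t) (h3.mono_set hsub)]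
  simp only [Pi.sub_apply, Pi.smul_apply, smul_eq_mul]
  rw [ornsteinUhlenbeck_eq hα lam0 (hXc ω) ht.1, ornsteinUhlenbeck_eq hα lam0 (hXc' ω) ht.1, h1, h2]
  simp

end Main

end FracOU

/-! ### The main theorem -/

theorem mainTheorem2 {Ω : Type*} [MeasurableSpace Ω] (P : Measure Ω) [IsProbabilityMeasure P]
    [P.IsComplete]
    (W : ℝ → Ω → ℝ) (hWm : ∀ t, Measurable (W t))
    (hW : FracOU.IsFractionalBrownianMotion (1 / 2) W P)
    (B : ℝ≥0 → Ω → ℝ) (hBm : ∀ t, Measurable (B t)) (hB : IsBrownianReal B P)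
    (hWB : IndepFun (fun ω t => W t ω) (fun ω t => B t ω) P)
    (T : ℝ) (hT : 0 < T) (ρ : ℝ) (hρ : ρ ∈ Ioo (0 : ℝ) 1)
    (Q : FracOU.QuadraticVariation P (FracOU.completedFiltration P W B hWm hBm) T
      (fun t ω => ρ * W t ω + √(1 - ρ ^ 2) * B t.toNNReal ω))
    (β : ℝ) (hβ : 1 < β) (α : ℝ) (hα : 0 < α)
    (lam0 : Ω → ℝ)
    (hlam0 : Measurable[FracOU.completedFiltration P W B hWm hBm 0] lam0)
    (hlam0' : MemLp lam0 (ENNReal.ofReal (2 * β)) P)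
    (BH : ℝ → ℝ → Ω → ℝ)
    (hBH : ∀ H ∈ Ioo (0 : ℝ) 1, FracOU.IsFractionalBrownianMotion H (BH H) P)
    (hrep : ∀ H ∈ Ioo (0 : ℝ) 1, ∀ t, 0 ≤ t →
      FracOU.IsWienerIntegral W P (FracOU.kernel H t) (BH H t)) :
    -- the kernel is differentiable in `H`
    (∀ H ∈ Ioo (0 : ℝ) 1, ∀ t, 0 ≤ t → ∀ s,
      HasDerivAt (fun h => FracOU.kernel h t s) (FracOU.kernelDeriv H t s) H) ∧
    -- the pathwise Riemann–Stieltjes integrals defining the processes exist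
    (∀ H ∈ Ioo (0 : ℝ) 1, ∀ ω, ∀ t ∈ Icc 0 T,
      FracOU.HasRSIntegral (fun u => Real.exp (α * u)) (fun u => BH H u ω) 0 t
        (FracOU.rsIntegral (fun u => Real.exp (α * u)) (fun u => BH H u ω) 0 t)) ∧
    -- the process of Wiener integrals of `∂_H K^H(t, ·)` has a progressively measurable version
    (∀ H ∈ Ioo (0 : ℝ) 1, ∃ Y : ℝ → Ω → ℝ,
      FracOU.IsProgressiveOn (FracOU.completedFiltration P W B hWm hBm) T Y ∧
      ∀ t ∈ Icc 0 T, FracOU.IsWienerIntegral W P (FracOU.kernelDeriv H t) (Y t)) ∧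
    -- `H ↦ λ^H` takes values in `𝓓_β` and is Fréchet differentiable with derivative `Dλ^H`
    ∃ Λ : ℝ → FracOU.DSpace Q hβ,
      (∀ H ∈ Ioo (0 : ℝ) 1, ∃ h : FracOU.ornsteinUhlenbeck α lam0 (BH H) ∈
        FracOU.processSpace Q hβ, Λ H = FracOU.DSpace.of Q hβ _ h) ∧
      ∀ H ∈ Ioo (0 : ℝ) 1, ∀ Y : ℝ → Ω → ℝ,
        FracOU.IsProgressiveOn (FracOU.completedFiltration P W B hWm hBm) T Y →
        (∀ t ∈ Icc 0 T, FracOU.IsWienerIntegral W P (FracOU.kernelDeriv H t) (Y t)) →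
        (∀ᵐ ω ∂P, IntervalIntegrable (fun u => Y u ω * Real.exp (α * u)) volume 0 T) ∧
        ∃ h : FracOU.derivProcess α Y ∈ FracOU.processSpace Q hβ,
          HasFDerivAt Λ (ContinuousLinearMap.toSpanSingleton ℝ
            (FracOU.DSpace.of Q hβ (FracOU.derivProcess α Y) h)) H := by
  classical
  have hT0 : 0 ≤ T := hT.le
  have hα0 : 0 ≤ α := hα.le
  have hρ2 : ρ ^ 2 ≤ 1 := pow_le_one₀ hρ.1.le hρ.2.le
  have hclock : ∀ᵐ ω ∂P, FracOU.clock Q ω = volume.restrict (Ioc 0 T) :=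
    Q.ae_clock_eq (FracOU.isPreBrownianReal_correlated hW hB.toIsPreBrownianReal hWB hρ2)
      (fun t => by simp) hT0
  have hc : ∀ H ∈ Ioo (0 : ℝ) 1, ∀ ω, Continuous fun t => BH H t ω := fun H hH =>
    (hBH H hH).continuous_paths
  have hmem : ∀ H ∈ Ioo (0 : ℝ) 1, FracOU.ornsteinUhlenbeck α lam0 (BH H) ∈
      FracOU.processSpace Q hβ := fun H hH =>
    FracOU.ornsteinUhlenbeck_mem_processSpace hW hT0 hα0 hβ hclock hlam0 hlam0' hH (hc H hH)
      (hrep H hH)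
  refine ⟨fun H hH t _ s => FracOU.hasDerivAt_kernel hH t s, fun H hH ω t _ =>
    FracOU.hasRSIntegral_rsIntegral (FracOU.hasRSIntegral_exp hα0 (hc H hH ω) t), fun H hH =>
    FracOU.exists_isProgressiveOn_isWienerIntegral_kernelDeriv hW hT0 hc hrep hH,
    -- The value `0` outside `(0, 1)` is arbitrary; the interval is open, so it does not affect
    -- derivatives at its points.
    fun H => if hH : H ∈ Ioo (0 : ℝ) 1 then FracOU.DSpace.of Q hβ _ (hmem H hH) else 0,
    fun H hH => ⟨hmem H hH, dif_pos hH⟩, fun H hH Y hYp hYw => ?_⟩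
  obtain ⟨A, hA⟩ := FracOU.exists_eLpNorm_kernelDeriv_le hH hT0
  have hY := FracOU.mem_processSpace_of_isWienerIntegral hW hβ hclock hYp hYw hA
  have hYi := FracOU.ae_intervalIntegrable_mul hT0 hclock hY
    (by fun_prop : Continuous fun u => Real.exp (α * u))
  have hD := FracOU.derivProcess_mem_processSpace_of_isWienerIntegral hW hα0 hβ hclock hYp hYw hA
  refine ⟨hYi, hD, ?_⟩
  rw [← hasDerivAt_iff_hasFDerivAt, hasDerivAt_iff_isLittleO, Asymptotics.isLittleO_iff]
  intro c hc0
  set C := (FracOU.derivBound α β T).toReal with hC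
  -- A kernel remainder of size `η |h - H|` becomes `C η |h - H|` in `𝓓_β`, and `C * (c / (C + 1)) ≤
  -- c` even if `C = 0`.
  have hη : 0 < c / (C + 1) := by positivity
  obtain ⟨δ, hδ, hker⟩ := FracOU.eLpNorm_kernel_sub_le hH hT0 hη
  filter_upwards [Ioo_mem_nhds hH.1 hH.2, Metric.ball_mem_nhds H hδ] with h hh hball
  rw [dif_pos hh, dif_pos hH]
  have hprog : FracOU.IsProgressiveOn (FracOU.completedFiltration P W B hWm hBm) T
      fun t ω => BH h t ω - BH H t ω - (h - H) * Y t ω := by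
    have h1 := FracOU.isProgressiveOn_of_isWienerIntegral_kernel (hWm := hWm) (hBm := hBm) (T := T)
      hW (hc h hh) (hrep h hh)
    have h2 := FracOU.isProgressiveOn_of_isWienerIntegral_kernel (hWm := hWm) (hBm := hBm) (T := T)
      hW (hc H hH) (hrep H hH)
    exact fun t ht => ((h1 t ht).sub (h2 t ht)).sub ((hYp t ht).const_mul _)
  have hbound := FracOU.betaNorm_derivProcess_le_of_isWienerIntegral (Q := Q) hW hα0 hβ hclock hprog
    (fun t ht => FracOU.isWienerIntegral_kernel_remainder hW (hrep h hh t ht.1) (hrep H hH t ht.1)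
      (hYw t ht)) (hker h hball)
  -- The bound on `derivProcess α` of the driver remainder is transferred to the remainder of the
  -- Ornstein–Uhlenbeck processes themselves.
  rw [← FracOU.betaNorm_congr (FracOU.ae_ornsteinUhlenbeck_sub_sub_eq hW hα0 lam0 (hc h hh)
    (hc H hH) (hrep h hh 0 le_rfl) (hrep H hH 0 le_rfl) hYi)] at hbound
  have hreal := ENNReal.toReal_mono (ENNReal.mul_ne_top (FracOU.derivBound_lt_top α β T).ne
    ENNReal.ofReal_ne_top) hbound
  rw [ENNReal.toReal_mul, ENNReal.toReal_ofReal (by positivity)] at hreal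
  -- The norm in the quotient unfolds to `betaNorm` of the representing process, so `hreal` is
  -- already the estimate for the remainder.
  refine hreal.trans ?_
  rw [Real.norm_eq_abs, ← hC, ← mul_assoc]
  refine mul_le_mul_of_nonneg_right ?_ (abs_nonneg _)
  rw [mul_div_assoc', div_le_iff₀ (by positivity)]
  nlinarith
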